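/- For real $a,b,c,d,e$ put $$J_3(a,b,c,d,e)=\iiint_{(0,1)^3}\frac{x^{b}(1-x)^{c}\,y^{e}(1-y)^{a}\,z^{a}(1-z)^{c}}{(1-(1-xy)z)^{d}}\,dx\,dy\,dz,\qquad K(a,b,c,d,e)=\frac{J_3(a,b,c,d+1,e)}{J_3(a,b,c,d,e)}.$$ Then $$K\left(\tfrac17,0,\tfrac27,\tfrac37,\tfrac47\right)=-\frac{189(8-5K_5)}{832-525K_5},\qquad K_5=\frac{2^{2/7}\sqrt\pi\,\Gamma(9/14)}{\cos(3\pi/14)\,\Gamma(4/7)^2}.$$ Similar evaluations hold for three further parameter choices with denominators 7, namely $$K\left(\tfrac17,0,\tfrac27,\tfrac57,\tfrac37\right)=-\frac{3(5-16L_1)}{23-70L_1},\qquad L_1=\frac{\Gamma(2/7)^2\,\Gamma(4/7)}{\Gamma(1/7)^2\,\Gamma(6/7)},$$ $$K\left(\tfrac17,0,\tfrac37,\tfrac47,\tfrac57\right)=-\frac{21(25-27L_2)}{425-462L_2},\qquad L_2=\frac{\Gamma(3/7)^2\,\Gamma(6/7)}{\Gamma(2/7)\,\Gamma(5/7)^2},$$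 $$K\left(\tfrac17,0,\tfrac47,\tfrac27,\tfrac57\right)=-\frac{33(11-294L_3)}{101-2744L_3},\qquad L_3=\frac{\Gamma(3/7)\,\Gamma(4/7)^2}{\Gamma(1/7)^2\,\Gamma(2/7)}.$$ In all four cases both triple integrals converge absolutely and the denominator $J_3(a,b,c,d,e)$ is nonzero. -/

import Mathlib

open Real Set MeasureTheory

/-- The open unit cube `(0,1)³`; a point is `(x, y, z)`. -/
def unitCube : Set (ℝ × ℝ × ℝ) := Ioo 0 1 ×ˢ Ioo 0 1 ×ˢ Ioo 0 1

/-- The integrand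
`x^(n+b) (1-x)^(n+c) y^(n+e) (1-y)^(n+a) z^(n+a) (1-z)^(n+c) / (1-(1-xy)z)^(n+d)`. -/
noncomputable def J3Integrand (a b c d e : ℝ) (n : ℕ) (p : ℝ × ℝ × ℝ) : ℝ :=
  p.1 ^ (n + b) * (1 - p.1) ^ (n + c) * p.2.1 ^ (n + e) * (1 - p.2.1) ^ (n + a) *
    p.2.2 ^ (n + a) * (1 - p.2.2) ^ (n + c) / (1 - (1 - p.1 * p.2.1) * p.2.2) ^ (n + d)

/-- Absolute convergence of the triple integral `J₃(a,b,c,d,e;n)`. -/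
def J3Converges (a b c d e : ℝ) (n : ℕ) : Prop :=
  IntegrableOn (J3Integrand a b c d e n) unitCube volume

/-- The triple integral `J₃(a,b,c,d,e;n)` over `(0,1)³`. -/
noncomputable def J3 (a b c d e : ℝ) (n : ℕ) : ℝ :=
  ∫ p in unitCube, J3Integrand a b c d e n p

/-- `K(a,b,c,d,e) = J₃(a,b,c,d+1,e;0) / J₃(a,b,c,d,e;0)`. -/
noncomputable def K (a b c d e : ℝ) : ℝ := J3 a b c (d + 1) e 0 / J3 a b c d e 0

/-- `K(a,b,c,d,e)` is well defined, as a quotient of two convergent integrals with nonzero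
denominator, and its value is `v`. -/
def KHasValue (a b c d e v : ℝ) : Prop :=
  J3Converges a b c (d + 1) e 0 ∧ J3Converges a b c d e 0 ∧ J3 a b c d e 0 ≠ 0 ∧
    K a b c d e = v

/-- `K₅ = 2^(2/7) √π Γ(9/14) / (cos(3π/14) Γ(4/7)²)`. -/
noncomputable def K5 : ℝ :=
  2 ^ (2 / 7 : ℝ) * √π * Gamma (9 / 14) / (cos (3 * π / 14) * Gamma (4 / 7) ^ 2)

/-- The gamma quotient in the evaluation of `K(1/7, 0, 2/7, 5/7, 3/7)`. -/
noncomputable def L1 : ℝ :=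
  Gamma (2 / 7) ^ 2 * Gamma (4 / 7) / (Gamma (1 / 7) ^ 2 * Gamma (6 / 7))

/-- The gamma quotient in the evaluation of `K(1/7, 0, 3/7, 4/7, 5/7)`. -/
noncomputable def L2 : ℝ :=
  Gamma (3 / 7) ^ 2 * Gamma (6 / 7) / (Gamma (2 / 7) * Gamma (5 / 7) ^ 2)

/-- The gamma quotient in the evaluation of `K(1/7, 0, 4/7, 2/7, 5/7)`. -/
noncomputable def L3 : ℝ :=
  Gamma (3 / 7) * Gamma (4 / 7) ^ 2 / (Gamma (1 / 7) ^ 2 * Gamma (2 / 7))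

/-! Let the two exponents `a` and the two exponents `c` vary separately, as `a₁`, `a₂`, `c₁`, `c₂`
with `c₁ + a₁ = c₂ + a₂`. An explicit vector field on the cube, whose divergence is the kernel times
a polynomial, links the integral at `(a₂, c₁, e)` to the one at `(a₂ + 1, c₁ + 1, e + 1)`. Since `b
= 0`, the face `x = 0` survives and contributes a product of two beta integrals
(`Admissible.contiguous`). Divided by `normConst`, the relation telescopes; the remainder tends to
zero, and the integral becomes a very-well-poised series with four parameters
(`Admissible.tendsto_sum_wpTerm`).

Such a series is summable by Dougall's `₅F₄` theorem when one parameter equals the leading one. In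
the four cases either `a + c - d` or `e + c - d` is an integer, so the series is a Dougall series
with its first few terms missing. Hence each integral is a Gamma factor times Dougall's value minus
a finite sum (`kernelIntegral_eq_of_dougall`), and the quotient of the integrals at `d + 1` and `d`
reduces to an identity between values of Gamma at sevenths.

Dougall's theorem comes from the same series: for `d = a₂ + c₂ + 2` the triple integral splits into
beta integrals, which gives the sum on a range of parameters (`DougallSum.of_range`). Telescoping
contiguous relations (`DougallSum.of_add_one_left`, `DougallSum.of_add_one_right`) carry it to the
parameters needed. -/

open Filter Topology

/-! ### Asymptotics of Gamma quotients -/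

/-- `x` is not a pole of the Gamma function. -/
def NonPole (x : ℝ) : Prop := ∀ n : ℕ, x ≠ -n

lemma NonPole.of_pos {x : ℝ} (hx : 0 < x) : NonPole x := fun n h => by
  have : (0 : ℝ) ≤ n := n.cast_nonneg
  linarith

lemma NonPole.add_nat_ne {x : ℝ} (hx : NonPole x) (n : ℕ) : x + n ≠ 0 := fun h =>
  hx n (by linarith)

lemma NonPole.ne_zero {x : ℝ} (hx : NonPole x) : x ≠ 0 := by simpa using hx 0

lemma NonPole.Gamma_ne {x : ℝ} (hx : NonPole x) : Gamma x ≠ 0 := Gamma_ne_zero hx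

lemma NonPole.Gamma_nat_ne {x : ℝ} (hx : NonPole x) (n : ℕ) : Gamma (x + n) ≠ 0 :=
  Gamma_ne_zero fun m h => hx (n + m) (by push_cast; linarith)

lemma NonPole.Gamma_succ {x : ℝ} (hx : NonPole x) (n : ℕ) :
    Gamma (x + (n + 1)) = (x + n) * Gamma (x + n) := by
  rw [← add_assoc, Gamma_add_one (hx.add_nat_ne n)]

lemma NonPole.prod_range {x : ℝ} (hx : NonPole x) (n : ℕ) :
    (∏ j ∈ Finset.range n, (x + j)) * Gamma x = Gamma (x + n) := by
  induction n with
  | zero => simp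
  | succ n ih =>
    push_cast
    rw [Finset.prod_range_succ, hx.Gamma_succ, ← ih]
    ring

lemma NonPole.of_seventh {p : ℤ} (hp : ¬ (7 : ℤ) ∣ p) : NonPole ((p : ℝ) / 7) := fun n h => by
  apply hp
  refine ⟨-n, ?_⟩
  have : (p : ℝ) = 7 * (-n) := by linarith
  exact_mod_cast this

/-- `Γ(u+n)/Γ(v+n)` is asymptotic to `n^(u-v)`. -/
lemma tendsto_Gamma_ratio {u v : ℝ} (hu : NonPole u) (hv : NonPole v) :
    Tendsto (fun n : ℕ => Gamma (u + n) / Gamma (v + n) * (n : ℝ) ^ (v - u)) atTop (𝓝 1) := by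
  -- Euler's limit for `Γ(v)` divided by that for `Γ(u)`: the factorials cancel and the products are
  -- themselves Gamma quotients. They have `n + 1` factors, hence the correction `(v + n) / (u + n)`
  -- below.
  have h1 := ((GammaSeq_tendsto_Gamma v).div (GammaSeq_tendsto_Gamma u) hu.Gamma_ne).mul_const
    (Gamma u / Gamma v)
  have e1 : Gamma v / Gamma u * (Gamma u / Gamma v) = 1 := by
    have := hu.Gamma_ne; have := hv.Gamma_ne
    field_simp
  rw [e1] at h1
  have h2 : Tendsto (fun n : ℕ => (v + n) / (u + n)) atTop (𝓝 1) := by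
    have h3 : Tendsto (fun n : ℕ => (v - u) * (u + (n : ℝ))⁻¹ + 1) atTop (𝓝 ((v - u) * 0 + 1)) := by
      refine Tendsto.add_const 1 (Tendsto.const_mul (v - u) ?_)
      exact tendsto_inv_atTop_zero.comp (tendsto_atTop_add_const_left _ _ tendsto_natCast_atTop_atTop)
    rw [mul_zero, zero_add] at h3
    refine h3.congr fun n => ?_
    have := hu.add_nat_ne n
    field_simp
    ring
  have h4 := h1.mul h2
  rw [one_mul] at h4
  refine h4.congr' ?_
  filter_upwards [eventually_gt_atTop 0] with n hn
  have hn' : (0 : ℝ) < n := by exact_mod_cast hn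
  have pu := hu.prod_range (n + 1)
  have pv := hv.prod_range (n + 1)
  push_cast at pu pv
  rw [hu.Gamma_succ] at pu
  rw [hv.Gamma_succ] at pv
  have nu := hu.add_nat_ne n
  have nv := hv.add_nat_ne n
  have gu := hu.Gamma_ne
  have gv := hv.Gamma_ne
  have gun := hu.Gamma_nat_ne n
  have gvn := hv.Gamma_nat_ne n
  have qu : ∏ j ∈ Finset.range (n + 1), (u + (j : ℝ)) = (u + n) * Gamma (u + n) / Gamma u := by
    rw [← pu]; field_simp
  have qv : ∏ j ∈ Finset.range (n + 1), (v + (j : ℝ)) = (v + n) * Gamma (v + n) / Gamma v := by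
    rw [← pv]; field_simp
  have hfac : (n.factorial : ℝ) ≠ 0 := by positivity
  have hpu : (n : ℝ) ^ u ≠ 0 := (rpow_pos_of_pos hn' u).ne'
  simp only [GammaSeq, Pi.div_apply]
  rw [qu, qv, rpow_sub hn']
  field_simp

/-! ### Very-well-poised terms and their decay -/

/-- The Gamma product of a well-poised term with four parameters. -/
noncomputable def wpProd (A B C D E : ℝ) (k : ℕ) : ℝ :=
  Gamma (B + k) / Gamma (1 + A - B + k) * (Gamma (C + k) / Gamma (1 + A - C + k)) *
    (Gamma (D + k) / Gamma (1 + A - D + k)) * (Gamma (E + k) / Gamma (1 + A - E + k))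

/-- The very-well-poised term with four parameters. -/
noncomputable def wpTerm (A B C D E : ℝ) (k : ℕ) : ℝ := (A + 2 * k) * wpProd A B C D E k

lemma tendsto_wpProd {A B C D E : ℝ} (hB : NonPole B) (hC : NonPole C) (hD : NonPole D)
    (hE : NonPole E) (hB' : NonPole (1 + A - B)) (hC' : NonPole (1 + A - C))
    (hD' : NonPole (1 + A - D)) (hE' : NonPole (1 + A - E)) :
    Tendsto (fun n : ℕ => wpProd A B C D E n * (n : ℝ) ^ (4 * (1 + A) - 2 * (B + C + D + E)))
      atTop (𝓝 1) := by
  have h := (((tendsto_Gamma_ratio hB hB').mul (tendsto_Gamma_ratio hC hC')).mul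
    (tendsto_Gamma_ratio hD hD')).mul (tendsto_Gamma_ratio hE hE')
  simp only [mul_one] at h
  refine h.congr' ?_
  filter_upwards [eventually_gt_atTop 0] with n hn
  have hn' : (0 : ℝ) < n := by exact_mod_cast hn
  have : (4 * (1 + A) - 2 * (B + C + D + E)) =
    (1 + A - B - B) + (1 + A - C - C) + (1 + A - D - D) + (1 + A - E - E) := by ring
  rw [this, rpow_add hn', rpow_add hn', rpow_add hn', wpProd]
  ring

lemma tendsto_mul_rpow_zero {f : ℕ → ℝ} {p q : ℝ}
    (h : Tendsto (fun n : ℕ => f n * (n : ℝ) ^ p) atTop (𝓝 1)) (hq : q < p) :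
    Tendsto (fun n : ℕ => f n * (n : ℝ) ^ q) atTop (𝓝 0) := by
  have h2 : Tendsto (fun n : ℕ => (n : ℝ) ^ (-(p - q))) atTop (𝓝 0) :=
    (tendsto_rpow_neg_atTop (by linarith)).comp tendsto_natCast_atTop_atTop
  have h3 := h.mul h2
  rw [one_mul] at h3
  refine h3.congr' ?_
  filter_upwards [eventually_gt_atTop 0] with n hn
  have hn' : (0 : ℝ) < n := by exact_mod_cast hn
  rw [mul_assoc, ← rpow_add hn']
  congr 2
  ring

lemma tendsto_add_div_nat (a : ℝ) :
    Tendsto (fun n : ℕ => (a + (n : ℝ)) / n) atTop (𝓝 1) := by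
  have h : Tendsto (fun n : ℕ => a * (n : ℝ)⁻¹ + 1) atTop (𝓝 (a * 0 + 1)) :=
    ((tendsto_inv_atTop_zero.comp tendsto_natCast_atTop_atTop).const_mul a).add_const 1
  rw [mul_zero, zero_add] at h
  refine h.congr' ?_
  filter_upwards [eventually_gt_atTop 0] with n hn
  have hn' : (n : ℝ) ≠ 0 := by exact_mod_cast hn.ne'
  field_simp

/-! ### Dougall's sum and its contiguous relations -/

/-- The value of Dougall's `₅F₄` sum, in the normalisation of `wpTerm A A B C D`. -/
noncomputable def dougallValue (A B C D : ℝ) : ℝ :=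
  Gamma B * Gamma C * Gamma D * Gamma (1 + A - B - C - D) /
    (Gamma (1 + A - B - C) * Gamma (1 + A - B - D) * Gamma (1 + A - C - D))

/-- Dougall's `₅F₄` summation holds at the given parameters. -/
def DougallSum (A B C D : ℝ) : Prop :=
  Tendsto (fun N : ℕ => ∑ k ∈ Finset.range N, wpTerm A A B C D k) atTop (𝓝 (dougallValue A B C D))

/-- The parameters avoid all poles of the summands and of the value. -/
structure DougallRegular (A B C D : ℝ) : Prop where
  nA : NonPole A
  nB : NonPole B
  nC : NonPole C
  nD : NonPole D
  nB' : NonPole (1 + A - B)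
  nC' : NonPole (1 + A - C)
  nD' : NonPole (1 + A - D)
  nBC : NonPole (1 + A - B - C)
  nBD : NonPole (1 + A - B - D)
  nCD : NonPole (1 + A - C - D)

/-- With `s = 1 + A - B - C - D` the exponent is `2 * s + 2`; the positivity hypotheses on `s` below
are what make the telescoping boundary terms vanish. -/
lemma DougallRegular.tendsto_wpProd {A B C D : ℝ} (h : DougallRegular A B C D) :
    Tendsto (fun n : ℕ => wpProd A A B C D n * (n : ℝ) ^ (4 + 2 * A - 2 * (B + C + D)))
      atTop (𝓝 1) := by
  convert _root_.tendsto_wpProd h.nA h.nB h.nC h.nD (A := A) _ h.nB' h.nC' h.nD' using 4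
  · ring
  · rw [add_sub_cancel_right]; exact NonPole.of_pos one_pos

lemma wpProd_succ {A B C D : ℝ} (h : DougallRegular A B C D) (k : ℕ) :
    wpProd A A B C D (k + 1) = wpProd A A B C D k * ((A + k) * (B + k) * (C + k) * (D + k)) /
      ((1 + k) * (1 + A - B + k) * (1 + A - C + k) * (1 + A - D + k)) := by
  have e : 1 + A - A = 1 := by ring
  have h1 : NonPole 1 := NonPole.of_pos one_pos
  have := h1.add_nat_ne k
  have := h.nB'.add_nat_ne k
  have := h.nC'.add_nat_ne k
  have := h.nD'.add_nat_ne k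
  have := h1.Gamma_nat_ne k
  have := h.nB'.Gamma_nat_ne k
  have := h.nC'.Gamma_nat_ne k
  have := h.nD'.Gamma_nat_ne k
  simp only [wpProd, e]
  push_cast
  rw [h.nA.Gamma_succ, h.nB.Gamma_succ, h.nC.Gamma_succ, h.nD.Gamma_succ, h1.Gamma_succ,
    h.nB'.Gamma_succ, h.nC'.Gamma_succ, h.nD'.Gamma_succ]
  field_simp

lemma Finset.sum_range_telescope {f g : ℕ → ℝ} (h0 : g 0 = 0)
    (h : ∀ k, f k = g (k + 1) - g k) (N : ℕ) : ∑ k ∈ Finset.range N, f k = g N := by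
  simp_rw [h]
  rw [Finset.sum_range_sub, h0, sub_zero]

/-- A fixed linear combination of the terms at `A + 1` and at `A` is the difference of the rational
multiple `G` of `wpProd`. Since `G` decays like `k ^ (-2 * s)` with `s = 1 + A - B - C - D`, the two
sums are proportional, in the ratio dictated by Dougall's value. -/
lemma DougallSum.of_add_one_left {A B C D : ℝ} (h : DougallRegular A B C D)
    (hs : 0 < 1 + A - B - C - D) (hd : DougallSum (A + 1) B C D) : DougallSum A B C D := by
  have e1 : ∀ B, 1 + (A + 1) - B = (1 + A - B) + 1 := fun B => by ring
  set G : ℕ → ℝ := fun k => k * (A + (1 + A - B - C - D) + k) * wpProd A A B C D k with hG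
  set P := (1 + A - B - C) * (1 + A - B - D) * (1 + A - C - D) with hP
  have key : ∀ N : ℕ, ∑ k ∈ Finset.range N, (P * wpTerm (A + 1) (A + 1) B C D k -
      (1 + A - B - C - D) * wpTerm A A B C D k) = G N := by
    refine Finset.sum_range_telescope (by simp [hG]) fun k => ?_
    have h1 : NonPole 1 := NonPole.of_pos one_pos
    have n1 := h1.add_nat_ne k
    have n2 := h.nB'.add_nat_ne k
    have n3 := h.nC'.add_nat_ne k
    have n4 := h.nD'.add_nat_ne k
    have g1 := h1.Gamma_nat_ne k
    have g2 := h.nB'.Gamma_nat_ne k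
    have g3 := h.nC'.Gamma_nat_ne k
    have g4 := h.nD'.Gamma_nat_ne k
    have e : 1 + A - A = 1 := by ring
    have ht : wpProd (A + 1) (A + 1) B C D k = wpProd A A B C D k * (A + k) /
        ((1 + A - B + k) * (1 + A - C + k) * (1 + A - D + k)) := by
      have e2 : ∀ x : ℝ, x + 1 + (k : ℝ) = x + (k + 1) := fun x => by ring
      simp only [wpProd, e1]
      rw [show 1 + A - (A + 1) + 1 = 1 by ring, e, e2, e2, e2, e2, h.nA.Gamma_succ,
        h.nB'.Gamma_succ, h.nC'.Gamma_succ, h.nD'.Gamma_succ]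
      field_simp
    simp only [hG, wpTerm, ht, wpProd_succ h, hP]
    push_cast
    field_simp
    ring
  have hG0 : Tendsto G atTop (𝓝 0) := by
    have h2 := tendsto_mul_rpow_zero (q := 2) h.tendsto_wpProd (by linarith)
    have h3 := (h2.mul (tendsto_add_div_nat (A + (1 + A - B - C - D))))
    rw [zero_mul] at h3
    refine h3.congr' ?_
    filter_upwards [eventually_gt_atTop 0] with n hn
    have hn' : (n : ℝ) ≠ 0 := by exact_mod_cast hn.ne'
    simp only [hG, rpow_two]
    field_simp
  have h4 := ((hd.const_mul P).sub hG0).div_const (1 + A - B - C - D)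
  have e5 : (P * dougallValue (A + 1) B C D - 0) / (1 + A - B - C - D) = dougallValue A B C D := by
    have e6 : 1 + (A + 1) - B - C - D = (1 + A - B - C - D) + 1 := by ring
    have e7 : 1 + (A + 1) - B - C = (1 + A - B - C) + 1 := by ring
    have e8 : 1 + (A + 1) - B - D = (1 + A - B - D) + 1 := by ring
    have e9 : 1 + (A + 1) - C - D = (1 + A - C - D) + 1 := by ring
    have := h.nBC.ne_zero; have := h.nBD.ne_zero; have := h.nCD.ne_zero
    have := h.nBC.Gamma_ne; have := h.nBD.Gamma_ne; have := h.nCD.Gamma_ne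
    rw [dougallValue, dougallValue, e6, e7, e8, e9, Gamma_add_one hs.ne',
      Gamma_add_one h.nBC.ne_zero, Gamma_add_one h.nBD.ne_zero, Gamma_add_one h.nCD.ne_zero]
    have := hs.ne'
    simp only [hP]
    field_simp
    ring
  rw [e5] at h4
  refine h4.congr fun N => ?_
  rw [← key N, Finset.sum_sub_distrib, ← Finset.mul_sum, ← Finset.mul_sum]
  have := hs.ne'
  field_simp
  ring

/-- Same method with a certificate `G` of degree four over `wpProd`. It grows two powers faster than
the previous one, so the condition is stronger by one: `A - B - C - D` must be positive. -/
lemma DougallSum.of_add_one_right {A B C D : ℝ} (h : DougallRegular A B C D)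
    (hAB : A - B ≠ 0) (hBC : A - B - C ≠ 0) (hBD : A - B - D ≠ 0)
    (hs : 0 < A - B - C - D) (hd : DougallSum A (B + 1) C D) : DougallSum A B C D := by
  set G : ℕ → ℝ := fun k => k * (A - B + k) * (A - C + k) * (A - D + k) * wpProd A A B C D k with hG
  set P := B * (A - B - C) * (A - B - D) with hP
  have nAB : NonPole (A - B) := fun n hn => by
    rcases n with _ | n
    · simp at hn; exact hAB hn
    · apply h.nB' n
      push_cast at hn
      linarith
  have key : ∀ N : ℕ, ∑ k ∈ Finset.range N, (P * wpTerm A A B C D k -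
      (A - B - C - D) * wpTerm A A (B + 1) C D k) = G N := by
    refine Finset.sum_range_telescope (by simp [hG]) fun k => ?_
    have h1 : NonPole 1 := NonPole.of_pos one_pos
    have n1 := h1.add_nat_ne k
    have n2 := h.nB'.add_nat_ne k
    have n3 := h.nC'.add_nat_ne k
    have n4 := h.nD'.add_nat_ne k
    have g1 := h1.Gamma_nat_ne k
    have g2 := nAB.Gamma_nat_ne k
    have g3 := h.nC'.Gamma_nat_ne k
    have g4 := h.nD'.Gamma_nat_ne k
    have n5 := nAB.add_nat_ne k
    have e : 1 + A - A = 1 := by ring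
    have ht : wpProd A A (B + 1) C D k = wpProd A A B C D k * (B + k) * (A - B + k) := by
      have e2 : B + 1 + (k : ℝ) = B + (k + 1) := by ring
      have e3 : 1 + A - (B + 1) + (k : ℝ) = A - B + k := by ring
      have e4 : 1 + A - B + (k : ℝ) = A - B + (k + 1) := by ring
      simp only [wpProd, e, e2, e3, e4]
      rw [h.nB.Gamma_succ, nAB.Gamma_succ]
      field_simp
    simp only [hG, wpTerm, ht, wpProd_succ h, hP]
    push_cast
    field_simp
    ring
  have hG0 : Tendsto G atTop (𝓝 0) := by
    have h2 := tendsto_mul_rpow_zero (q := (4 : ℕ)) h.tendsto_wpProd (by push_cast; linarith)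
    have h3 := (((h2.mul (tendsto_add_div_nat (A - B))).mul (tendsto_add_div_nat (A - C))).mul
      (tendsto_add_div_nat (A - D)))
    simp only [zero_mul] at h3
    refine h3.congr' ?_
    filter_upwards [eventually_gt_atTop 0] with n hn
    have hn' : (n : ℝ) ≠ 0 := by exact_mod_cast hn.ne'
    simp only [hG, rpow_natCast]
    field_simp
  have hP0 : P ≠ 0 := mul_ne_zero (mul_ne_zero h.nB.ne_zero hBC) hBD
  have h4 := ((hd.const_mul (A - B - C - D)).add hG0).div_const P
  have e5 : ((A - B - C - D) * dougallValue A (B + 1) C D + 0) / P = dougallValue A B C D := by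
    have e6 : 1 + A - B - C - D = (A - B - C - D) + 1 := by ring
    have e7 : 1 + A - B - C = (A - B - C) + 1 := by ring
    have e8 : 1 + A - B - D = (A - B - D) + 1 := by ring
    have e9 : 1 + A - (B + 1) - C - D = A - B - C - D := by ring
    have e10 : 1 + A - (B + 1) - C = A - B - C := by ring
    have e11 : 1 + A - (B + 1) - D = A - B - D := by ring
    have := h.nB.ne_zero
    rw [dougallValue, dougallValue, e6, e7, e8, e9, e10, e11, Gamma_add_one hs.ne',
      Gamma_add_one h.nB.ne_zero, Gamma_add_one hBC, Gamma_add_one hBD]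
    simp only [hP]
    field_simp
    ring
  rw [e5] at h4
  refine h4.congr fun N => ?_
  rw [← key N, Finset.sum_sub_distrib, ← Finset.mul_sum, ← Finset.mul_sum]
  field_simp
  ring

/-! ### Beta integrals and convergence over the cube -/

/-- Lebesgue measure on the open unit interval. -/
noncomputable abbrev unitMeasure : Measure ℝ := volume.restrict (Ioo 0 1)

lemma integrable_beta {p q : ℝ} (hp : -1 < p) (hq : -1 < q) :
    Integrable (fun x : ℝ => x ^ p * (1 - x) ^ q) unitMeasure := by
  have h := Complex.betaIntegral_convergent (u := ((p + 1 : ℝ) : ℂ)) (v := ((q + 1 : ℝ) : ℂ))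
    (by simp; linarith) (by simp; linarith)
  rw [intervalIntegrable_iff_integrableOn_Ioo_of_le zero_le_one] at h
  refine (h.re).congr ?_
  filter_upwards [ae_restrict_mem measurableSet_Ioo] with x hx
  have h1 : (x : ℂ) ^ (((p + 1 : ℝ) : ℂ) - 1) = ((x ^ p : ℝ) : ℂ) := by
    rw [Complex.ofReal_cpow hx.1.le]; push_cast; congr 1; ring
  have h2 : (1 - x : ℂ) ^ (((q + 1 : ℝ) : ℂ) - 1) = (((1 - x) ^ q : ℝ) : ℂ) := by
    rw [Complex.ofReal_cpow (by linarith [hx.2])]; push_cast; congr 1; ring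
  rw [h1, h2, ← Complex.ofReal_mul]
  simp

lemma integral_beta {p q : ℝ} (hp : -1 < p) (hq : -1 < q) :
    ∫ x, x ^ p * (1 - x) ^ q ∂unitMeasure = Gamma (p + 1) * Gamma (q + 1) / Gamma (p + q + 2) := by
  have h := ProbabilityTheory.beta_eq_betaIntegralReal (p + 1) (q + 1) (by linarith) (by linarith)
  rw [ProbabilityTheory.beta, show p + 1 + (q + 1) = p + q + 2 by ring] at h
  rw [h, Complex.betaIntegral, intervalIntegral.integral_of_le zero_le_one,
    integral_Ioc_eq_integral_Ioo, ← RCLike.re_to_complex, ← integral_re]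
  · refine setIntegral_congr_fun measurableSet_Ioo fun x hx => ?_
    have h1 : (x : ℂ) ^ (((p + 1 : ℝ) : ℂ) - 1) = ((x ^ p : ℝ) : ℂ) := by
      rw [Complex.ofReal_cpow hx.1.le]; push_cast; congr 1; ring
    have h2 : (1 - x : ℂ) ^ (((q + 1 : ℝ) : ℂ) - 1) = (((1 - x) ^ q : ℝ) : ℂ) := by
      rw [Complex.ofReal_cpow (by linarith [hx.2])]; push_cast; congr 1; ring
    simp only [h1, h2, ← Complex.ofReal_mul, RCLike.re_to_complex, Complex.ofReal_re]
  · have h := Complex.betaIntegral_convergent (u := ((p + 1 : ℝ) : ℂ)) (v := ((q + 1 : ℝ) : ℂ))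
      (by simp; linarith) (by simp; linarith)
    rwa [intervalIntegrable_iff_integrableOn_Ioo_of_le zero_le_one] at h

/-- Lebesgue measure on the open unit cube. -/
noncomputable abbrev cubeMeasure : Measure (ℝ × ℝ × ℝ) :=
  unitMeasure.prod (unitMeasure.prod unitMeasure)

lemma volume_restrict_unitCube : volume.restrict unitCube = cubeMeasure := by
  rw [unitCube, Measure.volume_eq_prod, ← Measure.prod_restrict, Measure.volume_eq_prod,
    ← Measure.prod_restrict]

lemma measurableSet_unitCube : MeasurableSet unitCube :=
  measurableSet_Ioo.prod (measurableSet_Ioo.prod measurableSet_Ioo)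

lemma ae_cubeMeasure_mem : ∀ᵐ p ∂cubeMeasure, p ∈ unitCube := by
  rw [← volume_restrict_unitCube]
  exact ae_restrict_mem measurableSet_unitCube

/-- The denominator `1 - (1 - xy)z`. -/
def den (x y z : ℝ) : ℝ := 1 - (1 - x * y) * z

/-- The kernel with independent exponents. -/
noncomputable def kernel (a₁ a₂ c₁ c₂ e d : ℝ) (p : ℝ × ℝ × ℝ) : ℝ :=
  (1 - p.1) ^ c₁ * (p.2.1 ^ e * (1 - p.2.1) ^ a₁) * (p.2.2 ^ a₂ * (1 - p.2.2) ^ c₂) *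
    den p.1 p.2.1 p.2.2 ^ (-d)

lemma den_ge_mul {x y z : ℝ} (hx : x ∈ Ioo (0 : ℝ) 1) (hy : y ∈ Ioo (0 : ℝ) 1)
    (hz : z ∈ Ioo (0 : ℝ) 1) : x * y ≤ den x y z := by
  have h1 : x * y ≤ 1 := mul_le_one₀ hx.2.le hy.1.le hy.2.le
  have : 0 ≤ (1 - z) * (1 - x * y) := mul_nonneg (by linarith [hz.2]) (by linarith)
  unfold den
  nlinarith

lemma den_ge_one_sub {x y z : ℝ} (hx : x ∈ Ioo (0 : ℝ) 1) (hy : y ∈ Ioo (0 : ℝ) 1)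
    (hz : z ∈ Ioo (0 : ℝ) 1) : 1 - z ≤ den x y z := by
  have : 0 ≤ x * y * z := mul_nonneg (mul_nonneg hx.1.le hy.1.le) hz.1.le
  unfold den
  nlinarith

lemma den_pos {x y z : ℝ} (hx : x ∈ Ioo (0 : ℝ) 1) (hy : y ∈ Ioo (0 : ℝ) 1)
    (hz : z ∈ Ioo (0 : ℝ) 1) : 0 < den x y z :=
  (mul_pos hx.1 hy.1).trans_le (den_ge_mul hx hy hz)

lemma measurable_kernel (a₁ a₂ c₁ c₂ e d : ℝ) : Measurable (kernel a₁ a₂ c₁ c₂ e d) := by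
  unfold kernel den
  fun_prop

lemma kernel_pos (a₁ a₂ c₁ c₂ e d : ℝ) {p : ℝ × ℝ × ℝ} (hp : p ∈ unitCube) :
    0 < kernel a₁ a₂ c₁ c₂ e d p := by
  obtain ⟨hx, hy, hz⟩ := hp
  have h1 : 0 < 1 - p.1 := by linarith [hx.2]
  have h2 : 0 < 1 - p.2.1 := by linarith [hy.2]
  have h3 : 0 < 1 - p.2.2 := by linarith [hz.2]
  have h4 := den_pos hx hy hz
  have h5 := hy.1
  have h6 := hz.1
  unfold kernel
  positivity

/-- A product majorant of the kernel. -/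
noncomputable def kernelBound (a₁ a₂ c₁ c₂ e d η : ℝ) (p : ℝ × ℝ × ℝ) : ℝ :=
  (p.1 ^ (-η) * (1 - p.1) ^ c₁) * ((p.2.1 ^ (e - η) * (1 - p.2.1) ^ a₁) *
    (p.2.2 ^ a₂ * (1 - p.2.2) ^ (c₂ - d + η)))

/-- The denominator dominates both `x * y` and `1 - z`. Spending the power `η` on the first bound
and `d - η` on the second separates the variables. -/
lemma kernel_le_bound {a₁ a₂ c₁ c₂ e d η : ℝ} (h0 : 0 ≤ η) (hd : η ≤ d) {p : ℝ × ℝ × ℝ}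
    (hp : p ∈ unitCube) : kernel a₁ a₂ c₁ c₂ e d p ≤ kernelBound a₁ a₂ c₁ c₂ e d η p := by
  obtain ⟨x, y, z⟩ := p
  obtain ⟨hx, hy, hz⟩ := hp
  simp only at hx hy hz
  have h1 : 0 < 1 - x := by linarith [hx.2]
  have h2 : 0 < 1 - y := by linarith [hy.2]
  have h3 : 0 < 1 - z := by linarith [hz.2]
  have h4 := den_pos hx hy hz
  have h5 := hy.1
  have h6 := hz.1
  have h7 := hx.1
  have hD : den x y z ^ (-d) ≤ (x ^ (-η) * y ^ (-η)) * (1 - z) ^ (-d + η) := by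
    rw [show -d = -η + (-d + η) by ring, rpow_add h4, ← mul_rpow h7.le h5.le]
    rw [show -η + (-d + η) + η = -d + η by ring]
    exact mul_le_mul (rpow_le_rpow_of_nonpos (mul_pos h7 h5) (den_ge_mul hx hy hz) (by linarith))
      (rpow_le_rpow_of_nonpos h3 (den_ge_one_sub hx hy hz) (by linarith)) (by positivity)
      (by positivity)
  simp only [kernel, kernelBound]
  rw [sub_eq_add_neg e, rpow_add h5, show c₂ - d + η = c₂ + (-d + η) by ring, rpow_add h3]
  calc _ ≤ (1 - x) ^ c₁ * (y ^ e * (1 - y) ^ a₁) * (z ^ a₂ * (1 - z) ^ c₂) *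
        ((x ^ (-η) * y ^ (-η)) * (1 - z) ^ (-d + η)) := by gcongr
    _ = _ := by ring

/-- Admissible exponents: the kernel is integrable over the cube. -/
structure Admissible (a₁ a₂ c₁ c₂ e d η : ℝ) : Prop where
  nonneg : 0 ≤ η
  le_d : η ≤ d
  lt_one : η < 1
  lt_e : η < e + 1
  lt_c : d - c₂ - 1 < η
  a₁_gt : -1 < a₁
  a₂_gt : -1 < a₂
  c₁_gt : -1 < c₁

/-- `lt_one`, `lt_e` and `lt_c` say exactly that the exponents of the majorant altered by `η`, those
of `x`, `y` and `1 - z`, exceed `-1`. -/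
lemma Admissible.integrable_bound {a₁ a₂ c₁ c₂ e d η : ℝ} (h : Admissible a₁ a₂ c₁ c₂ e d η) :
    Integrable (kernelBound a₁ a₂ c₁ c₂ e d η) cubeMeasure :=
  (integrable_beta (by linarith [h.lt_one]) h.c₁_gt).mul_prod
    ((integrable_beta (by linarith [h.lt_e]) h.a₁_gt).mul_prod
      (integrable_beta h.a₂_gt (by linarith [h.lt_c])))

lemma Admissible.integral_bound {a₁ a₂ c₁ c₂ e d η : ℝ} (h : Admissible a₁ a₂ c₁ c₂ e d η) :
    ∫ p, kernelBound a₁ a₂ c₁ c₂ e d η p ∂cubeMeasure =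
      Gamma (-η + 1) * Gamma (c₁ + 1) / Gamma (-η + c₁ + 2) *
      (Gamma (e - η + 1) * Gamma (a₁ + 1) / Gamma (e - η + a₁ + 2) *
      (Gamma (a₂ + 1) * Gamma (c₂ - d + η + 1) / Gamma (a₂ + (c₂ - d + η) + 2))) := by
  rw [← integral_beta (by linarith [h.lt_one]) h.c₁_gt,
    ← integral_beta (by linarith [h.lt_e]) h.a₁_gt,
    ← integral_beta h.a₂_gt (by linarith [h.lt_c]), ← integral_prod_mul, ← integral_prod_mul]
  rfl

lemma Admissible.integrable {a₁ a₂ c₁ c₂ e d η : ℝ} (h : Admissible a₁ a₂ c₁ c₂ e d η) :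
    Integrable (kernel a₁ a₂ c₁ c₂ e d) cubeMeasure := by
  refine h.integrable_bound.mono' (measurable_kernel ..).aestronglyMeasurable ?_
  filter_upwards [ae_cubeMeasure_mem] with p hp
  rw [norm_of_nonneg (kernel_pos _ _ _ _ _ _ hp).le]
  exact kernel_le_bound h.nonneg h.le_d hp

/-- The integral of the kernel over the unit cube. -/
noncomputable def kernelIntegral (a₁ a₂ c₁ c₂ e d : ℝ) : ℝ :=
  ∫ p, kernel a₁ a₂ c₁ c₂ e d p ∂cubeMeasure

lemma Admissible.integral_pos {a₁ a₂ c₁ c₂ e d η : ℝ} (h : Admissible a₁ a₂ c₁ c₂ e d η) :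
    0 < kernelIntegral a₁ a₂ c₁ c₂ e d := by
  have hi := h.integrable
  unfold kernelIntegral
  rw [← volume_restrict_unitCube] at hi ⊢
  rw [setIntegral_pos_iff_support_of_nonneg_ae]
  · have hsub : unitCube ⊆ Function.support (kernel a₁ a₂ c₁ c₂ e d) ∩ unitCube := fun p hp =>
      ⟨(kernel_pos _ _ _ _ _ _ hp).ne', hp⟩
    refine lt_of_lt_of_le ?_ (measure_mono hsub)
    rw [unitCube, Measure.volume_eq_prod, Measure.prod_prod, Measure.volume_eq_prod,
      Measure.prod_prod]
    simp
  · filter_upwards [ae_restrict_mem measurableSet_unitCube] with p hp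
    exact (kernel_pos _ _ _ _ _ _ hp).le
  · exact hi

lemma Admissible.integral_le {a₁ a₂ c₁ c₂ e d η : ℝ} (h : Admissible a₁ a₂ c₁ c₂ e d η) :
    kernelIntegral a₁ a₂ c₁ c₂ e d ≤
      Gamma (-η + 1) * Gamma (c₁ + 1) / Gamma (-η + c₁ + 2) *
      (Gamma (e - η + 1) * Gamma (a₁ + 1) / Gamma (e - η + a₁ + 2) *
      (Gamma (a₂ + 1) * Gamma (c₂ - d + η + 1) / Gamma (a₂ + (c₂ - d + η) + 2))) := by
  rw [← h.integral_bound]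
  refine integral_mono_ae h.integrable h.integrable_bound ?_
  filter_upwards [ae_cubeMeasure_mem] with p hp
  exact kernel_le_bound h.nonneg h.le_d hp

lemma J3Integrand_eq_kernel {a c d e : ℝ} {p : ℝ × ℝ × ℝ} (hp : p ∈ unitCube) :
    J3Integrand a 0 c d e 0 p = kernel a a c c e d p := by
  have := den_pos hp.1 hp.2.1 hp.2.2
  simp only [J3Integrand, kernel, CharP.cast_eq_zero, zero_add, rpow_zero, one_mul]
  rw [rpow_neg this.le, den]
  ring

lemma Admissible.J3Converges {a c d e η : ℝ} (h : Admissible a a c c e d η) :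
    J3Converges a 0 c d e 0 := by
  have hi := h.integrable
  rw [← volume_restrict_unitCube] at hi
  exact IntegrableOn.congr_fun hi (fun p hp => (J3Integrand_eq_kernel hp).symm)
    measurableSet_unitCube

lemma J3_eq_kernelIntegral (a c d e : ℝ) : J3 a 0 c d e 0 = kernelIntegral a a c c e d := by
  unfold J3 kernelIntegral
  rw [← volume_restrict_unitCube]
  exact setIntegral_congr_fun measurableSet_unitCube fun p hp => J3Integrand_eq_kernel hp

/-! ### Integration by parts on the cube -/

lemma integral_unit_of_hasDerivAt {f f' : ℝ → ℝ} (hd : ∀ x ∈ Ioo (0 : ℝ) 1, HasDerivAt f (f' x) x)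
    (hi : Integrable f' unitMeasure) (h0 : ContinuousAt f 0) (h1 : ContinuousAt f 1) :
    ∫ x, f' x ∂unitMeasure = f 1 - f 0 := by
  rw [← integral_Ioc_eq_integral_Ioo, ← intervalIntegral.integral_of_le zero_le_one]
  refine intervalIntegral.integral_eq_sub_of_hasDerivAt_of_tendsto zero_lt_one hd ?_
    (h0.tendsto.mono_left nhdsWithin_le_nhds) (h1.tendsto.mono_left nhdsWithin_le_nhds)
  rwa [intervalIntegrable_iff_integrableOn_Ioo_of_le zero_le_one]

/-- Fubini makes almost every slice integrable, so the fundamental theorem applies on the open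
interval with only continuity required at its ends. -/
lemma integral_cube_of_hasDerivAt_fst {F : ℝ × ℝ × ℝ → ℝ} (hF : Integrable F cubeMeasure)
    (f : ℝ → ℝ → ℝ → ℝ)
    (hd : ∀ x ∈ Ioo (0 : ℝ) 1, ∀ y ∈ Ioo (0 : ℝ) 1, ∀ z ∈ Ioo (0 : ℝ) 1,
      HasDerivAt (fun t => f t y z) (F (x, y, z)) x)
    (h0 : ∀ y ∈ Ioo (0 : ℝ) 1, ∀ z ∈ Ioo (0 : ℝ) 1, ContinuousAt (fun t => f t y z) 0)
    (h1 : ∀ y ∈ Ioo (0 : ℝ) 1, ∀ z ∈ Ioo (0 : ℝ) 1, ContinuousAt (fun t => f t y z) 1) :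
    ∫ p, F p ∂cubeMeasure =
      ∫ q, (f 1 q.1 q.2 - f 0 q.1 q.2) ∂(unitMeasure.prod unitMeasure) := by
  rw [integral_prod_symm _ hF]
  refine integral_congr_ae ?_
  have hm : ∀ᵐ q ∂(unitMeasure.prod unitMeasure), q ∈ Ioo (0 : ℝ) 1 ×ˢ Ioo (0 : ℝ) 1 := by
    rw [Measure.prod_restrict]
    exact ae_restrict_mem (measurableSet_Ioo.prod measurableSet_Ioo)
  filter_upwards [hm, hF.prod_left_ae] with q hq hi
  exact integral_unit_of_hasDerivAt (fun x hx => hd x hx q.1 hq.1 q.2 hq.2) hi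
    (h0 q.1 hq.1 q.2 hq.2) (h1 q.1 hq.1 q.2 hq.2)

lemma integral_cube_of_hasDerivAt_snd {F : ℝ × ℝ × ℝ → ℝ} (hF : Integrable F cubeMeasure)
    (f : ℝ → ℝ → ℝ → ℝ)
    (hd : ∀ x ∈ Ioo (0 : ℝ) 1, ∀ y ∈ Ioo (0 : ℝ) 1, ∀ z ∈ Ioo (0 : ℝ) 1,
      HasDerivAt (fun t => f x t z) (F (x, y, z)) y)
    (h0 : ∀ x ∈ Ioo (0 : ℝ) 1, ∀ z ∈ Ioo (0 : ℝ) 1,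
      ContinuousAt (fun t => f x t z) 0 ∧ f x 0 z = 0)
    (h1 : ∀ x ∈ Ioo (0 : ℝ) 1, ∀ z ∈ Ioo (0 : ℝ) 1,
      ContinuousAt (fun t => f x t z) 1 ∧ f x 1 z = 0) :
    ∫ p, F p ∂cubeMeasure = 0 := by
  rw [integral_prod _ hF]
  refine integral_eq_zero_of_ae ?_
  filter_upwards [ae_restrict_mem measurableSet_Ioo, hF.prod_right_ae] with x hx hi
  rw [integral_prod_symm _ hi]
  refine integral_eq_zero_of_ae ?_
  filter_upwards [ae_restrict_mem measurableSet_Ioo, hi.prod_left_ae] with z hz hi'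
  rw [integral_unit_of_hasDerivAt (f := fun t => f x t z) (fun y hy => hd x hx y hy z hz) hi'
    (h0 x hx z hz).1 (h1 x hx z hz).1, (h0 x hx z hz).2, (h1 x hx z hz).2]
  simp

lemma integral_cube_of_hasDerivAt_thd {F : ℝ × ℝ × ℝ → ℝ} (hF : Integrable F cubeMeasure)
    (f : ℝ → ℝ → ℝ → ℝ)
    (hd : ∀ x ∈ Ioo (0 : ℝ) 1, ∀ y ∈ Ioo (0 : ℝ) 1, ∀ z ∈ Ioo (0 : ℝ) 1,
      HasDerivAt (fun t => f x y t) (F (x, y, z)) z)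
    (h0 : ∀ x ∈ Ioo (0 : ℝ) 1, ∀ y ∈ Ioo (0 : ℝ) 1,
      ContinuousAt (fun t => f x y t) 0 ∧ f x y 0 = 0)
    (h1 : ∀ x ∈ Ioo (0 : ℝ) 1, ∀ y ∈ Ioo (0 : ℝ) 1,
      ContinuousAt (fun t => f x y t) 1 ∧ f x y 1 = 0) :
    ∫ p, F p ∂cubeMeasure = 0 := by
  rw [integral_prod _ hF]
  refine integral_eq_zero_of_ae ?_
  filter_upwards [ae_restrict_mem measurableSet_Ioo, hF.prod_right_ae] with x hx hi
  rw [integral_prod _ hi]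
  refine integral_eq_zero_of_ae ?_
  filter_upwards [ae_restrict_mem measurableSet_Ioo, hi.prod_right_ae] with y hy hi'
  rw [integral_unit_of_hasDerivAt (f := fun t => f x y t) (fun z hz => hd x hx y hy z hz) hi'
    (h0 x hx y hy).1 (h1 x hx y hy).1, (h0 x hx y hy).2, (h1 x hx y hy).2]
  simp

lemma hasDerivAt_rpow_mul_one_sub_rpow {x : ℝ} (hx : x ∈ Ioo (0 : ℝ) 1) (a b : ℝ) :
    HasDerivAt (fun t : ℝ => t ^ (a + 1) * (1 - t) ^ (b + 1))
      (x ^ a * (1 - x) ^ b * ((a + 1) * (1 - x) - (b + 1) * x)) x := by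
  have h1 : 0 < 1 - x := by linarith [hx.2]
  have h2 : HasDerivAt (fun t : ℝ => t ^ (a + 1)) ((a + 1) * x ^ a) x := by
    simpa using hasDerivAt_rpow_const (x := x) (p := a + 1) (Or.inl hx.1.ne')
  have h3 : HasDerivAt (fun t : ℝ => (1 - t) ^ (b + 1)) (-((b + 1) * (1 - x) ^ b)) x := by
    exact (((hasDerivAt_id x).const_sub 1).rpow_const (p := b + 1) (Or.inl h1.ne')).congr_deriv (by simp; ring)
  refine (h2.mul h3).congr_deriv ?_
  rw [rpow_add_one hx.1.ne', rpow_add_one h1.ne']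
  ring

lemma hasDerivAt_one_sub_rpow {x : ℝ} (hx : x < 1) (b : ℝ) :
    HasDerivAt (fun t : ℝ => (1 - t) ^ (b + 1)) (-((b + 1) * (1 - x) ^ b)) x := by
  have h1 : 1 - x ≠ 0 := by linarith
  exact (((hasDerivAt_id x).const_sub 1).rpow_const (p := b + 1) (Or.inl h1)).congr_deriv
    (by simp; ring)

lemma HasDerivAt.rpow_neg_const {g : ℝ → ℝ} {g' x : ℝ} (hg : HasDerivAt g g' x) (h : 0 < g x)
    (d : ℝ) : HasDerivAt (fun t => g t ^ (-d)) (-(d * g' / g x) * g x ^ (-d)) x := by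
  refine (hg.rpow_const (p := -d) (Or.inl h.ne')).congr_deriv ?_
  rw [rpow_sub_one h.ne']
  field_simp

/-- Differentiating the denominator produces no new singularity: `(1 - z) / den` lies in `[0, 1]`,
so a continuous function of it and of the coordinates is bounded. -/
lemma Admissible.integrable_mul {a₁ a₂ c₁ c₂ e d η : ℝ} (h : Admissible a₁ a₂ c₁ c₂ e d η)
    {g : ℝ × ℝ × ℝ × ℝ → ℝ} (hg : Continuous g) :
    Integrable (fun p => kernel a₁ a₂ c₁ c₂ e d p *
      g (p.1, p.2.1, p.2.2, (1 - p.2.2) / den p.1 p.2.1 p.2.2)) cubeMeasure := by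
  obtain ⟨C, hC⟩ := ((isCompact_Icc (a := (0 : ℝ)) (b := 1)).prod
    ((isCompact_Icc (a := (0 : ℝ)) (b := 1)).prod ((isCompact_Icc (a := (0 : ℝ)) (b := 1)).prod
      (isCompact_Icc (a := (0 : ℝ)) (b := 1))))).exists_bound_of_continuousOn hg.continuousOn
  refine h.integrable.mul_bdd (c := C) ?_ ?_
  · refine (hg.measurable.comp ?_).aestronglyMeasurable
    unfold den
    fun_prop
  · filter_upwards [ae_cubeMeasure_mem] with p hp
    obtain ⟨hx, hy, hz⟩ := hp
    refine hC _ ⟨⟨hx.1.le, hx.2.le⟩, ⟨hy.1.le, hy.2.le⟩, ⟨hz.1.le, hz.2.le⟩, ?_, ?_⟩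
    · exact div_nonneg (by linarith [hz.2]) (den_pos hx hy hz).le
    · exact div_le_one_of_le₀ (den_ge_one_sub hx hy hz) (den_pos hx hy hz).le

lemma den_zero_left (y z : ℝ) : den 0 y z = 1 - z := by simp [den]

lemma continuousAt_den_rpow {f g h : ℝ → ℝ} {t d : ℝ} (hf : ContinuousAt f t)
    (hg : ContinuousAt g t) (hh : ContinuousAt h t) (h0 : den (f t) (g t) (h t) ≠ 0) :
    ContinuousAt (fun s => den (f s) (g s) (h s) ^ (-d)) t := by
  refine ContinuousAt.rpow_const ?_ (Or.inl h0)
  unfold den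
  fun_prop

lemma continuousAt_rpow_of_pos {f : ℝ → ℝ} {t c : ℝ} (hf : ContinuousAt f t) (hc : -1 < c) :
    ContinuousAt (fun s => f s ^ (c + 1)) t :=
  hf.rpow_const (Or.inr (by linarith))

/-! ### The divergence identity and the contiguous relation -/

/-- The `x`-part of the divergence, relative to the kernel, in the variables
`x, y, z, (1 - z) / den x y z`. -/
def divX (a₁ c₁ e d : ℝ) (p : ℝ × ℝ × ℝ × ℝ) : ℝ :=
  -((c₁ + 1) * ((c₁ + 1) * (1 - p.2.2.1) + (2 + e + a₁ - d) * (1 - (1 - p.1 * p.2.1) * p.2.2.1))) +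
    (1 - p.1) * (2 + e + a₁ - d) * (p.2.1 * p.2.2.1) -
    d * ((1 - p.1) * (p.2.1 * p.2.2.1) * ((c₁ + 1) * p.2.2.2 + (2 + e + a₁ - d)))

/-- The `y`-part of the divergence. -/
def divY (a₁ c₁ e d : ℝ) (p : ℝ × ℝ × ℝ × ℝ) : ℝ :=
  -((c₁ + 1) * p.2.2.1) * ((e + 1) * (1 - p.2.1) - (a₁ + 1) * p.2.1 -
    d * ((1 - p.2.2.2) * (1 - p.2.1)))

/-- The `z`-part of the divergence. -/
def divZ (a₂ c₁ c₂ d : ℝ) (p : ℝ × ℝ × ℝ × ℝ) : ℝ :=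
  (c₁ + 1) * ((a₂ + 1) * (1 - p.2.2.1) - (c₂ + 1) * p.2.2.1 +
    d * ((1 - p.1 * p.2.1) * p.2.2.1 * p.2.2.2))

lemma continuous_divX (a₁ c₁ e d : ℝ) : Continuous (divX a₁ c₁ e d) := by unfold divX; fun_prop

lemma continuous_divY (a₁ c₁ e d : ℝ) : Continuous (divY a₁ c₁ e d) := by unfold divY; fun_prop

lemma continuous_divZ (a₂ c₁ c₂ d : ℝ) : Continuous (divZ a₂ c₁ c₂ d) := by unfold divZ; fun_prop

/-- The argument `(x, y, z, (1 - z) / den x y z)` of the divergence factors. -/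
noncomputable def withRatio (p : ℝ × ℝ × ℝ) : ℝ × ℝ × ℝ × ℝ :=
  (p.1, p.2.1, p.2.2, (1 - p.2.2) / den p.1 p.2.1 p.2.2)

lemma Admissible.neg_one_lt_e {a₁ a₂ c₁ c₂ e d η : ℝ} (h : Admissible a₁ a₂ c₁ c₂ e d η) :
    -1 < e := by linarith [h.lt_e, h.nonneg]

lemma Admissible.neg_one_lt_c₂ {a₁ a₂ c₁ c₂ e d η : ℝ} (h : Admissible a₁ a₂ c₁ c₂ e d η) :
    -1 < c₂ := by linarith [h.lt_c, h.le_d]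

/-- The field vanishes on `x = 1` because of the factor `(1 - x) ^ (c₁ + 1)`. On `x = 0` the
denominator is `1 - z`, so both terms of the field merge into one power of `1 - z`. -/
lemma Admissible.integral_divX {a₁ a₂ c₁ c₂ e d η : ℝ} (h : Admissible a₁ a₂ c₁ c₂ e d η) :
    ∫ p, kernel a₁ a₂ c₁ c₂ e d p * divX a₁ c₁ e d (withRatio p) ∂cubeMeasure =
      ∫ q, -((3 + a₁ + e + c₁ - d) * ((q.1 ^ e * (1 - q.1) ^ a₁) *
        (q.2 ^ a₂ * (1 - q.2) ^ (c₂ + 1 - d)))) ∂(unitMeasure.prod unitMeasure) := by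
  refine (integral_cube_of_hasDerivAt_fst (h.integrable_mul (continuous_divX a₁ c₁ e d))
    (fun x y z => (1 - x) ^ (c₁ + 1) * (((c₁ + 1) * (1 - z) + (2 + e + a₁ - d) * den x y z) *
      den x y z ^ (-d)) * ((y ^ e * (1 - y) ^ a₁) * (z ^ a₂ * (1 - z) ^ c₂))) ?_ ?_ ?_).trans
    (integral_congr_ae ?_)
  · intro x hx y hy z hz
    have hD := den_pos hx hy hz
    have hDx : HasDerivAt (fun t => den t y z) (y * z) x := by
      unfold den
      exact ((((hasDerivAt_id x).mul_const y).const_sub 1 |>.mul_const z).const_sub 1).congr_deriv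
        (by ring)
    refine HasDerivAt.congr_deriv (((hasDerivAt_one_sub_rpow hx.2 c₁).mul (((hDx.const_mul (2 + e + a₁ - d)).const_add
      ((c₁ + 1) * (1 - z))).mul (hDx.rpow_neg_const hD d))).mul_const
      ((y ^ e * (1 - y) ^ a₁) * (z ^ a₂ * (1 - z) ^ c₂))) ?_
    have h1 : 1 - x ≠ 0 := by linarith [hx.2]
    simp only [kernel, divX, Pi.mul_apply]
    rw [rpow_add_one h1]
    have := hD.ne'
    rw [show 1 - (1 - x * y) * z = den x y z from rfl]
    field_simp
    ring
  · intro y hy z hz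
    have h3 : den 0 y z ≠ 0 := by rw [den_zero_left]; linarith [hz.2]
    refine ((ContinuousAt.mul ?_ (ContinuousAt.mul ?_ ?_)).mul continuousAt_const)
    · exact continuousAt_rpow_of_pos (by fun_prop) h.c₁_gt
    · unfold den; fun_prop
    · exact continuousAt_den_rpow continuousAt_id continuousAt_const continuousAt_const h3
  · intro y hy z hz
    have h3 : den 1 y z ≠ 0 := by
      have : 0 < (1 - z) + y * z := add_pos (by linarith [hz.2]) (mul_pos hy.1 hz.1)
      unfold den; nlinarith
    refine ((ContinuousAt.mul ?_ (ContinuousAt.mul ?_ ?_)).mul continuousAt_const)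
    · exact continuousAt_rpow_of_pos (by fun_prop) h.c₁_gt
    · unfold den; fun_prop
    · exact continuousAt_den_rpow continuousAt_id continuousAt_const continuousAt_const h3
  · have hm : ∀ᵐ q ∂(unitMeasure.prod unitMeasure), q ∈ Ioo (0 : ℝ) 1 ×ˢ Ioo (0 : ℝ) 1 := by
      rw [Measure.prod_restrict]
      exact ae_restrict_mem (measurableSet_Ioo.prod measurableSet_Ioo)
    filter_upwards [hm] with q hq
    have hz : 0 < 1 - q.2 := by linarith [hq.2.2]
    simp only [den_zero_left, sub_self, sub_zero, one_rpow]
    rw [zero_rpow (by linarith [h.c₁_gt]), show c₂ + 1 - d = c₂ + 1 + -d by ring, rpow_add hz,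
      rpow_add_one hz.ne']
    ring

lemma Admissible.integral_divY {a₁ a₂ c₁ c₂ e d η : ℝ} (h : Admissible a₁ a₂ c₁ c₂ e d η) :
    ∫ p, kernel a₁ a₂ c₁ c₂ e d p * divY a₁ c₁ e d (withRatio p) ∂cubeMeasure = 0 := by
  refine integral_cube_of_hasDerivAt_snd (h.integrable_mul (continuous_divY a₁ c₁ e d))
    (fun x y z => (y ^ (e + 1) * (1 - y) ^ (a₁ + 1)) * den x y z ^ (-d) *
      (-((c₁ + 1) * z) * ((1 - x) ^ c₁ * (z ^ a₂ * (1 - z) ^ c₂)))) ?_ ?_ ?_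
  · intro x hx y hy z hz
    have hD := den_pos hx hy hz
    have hDy : HasDerivAt (fun t => den x t z) (x * z) y := by
      unfold den
      exact ((((hasDerivAt_id y).const_mul x).const_sub 1 |>.mul_const z).const_sub 1).congr_deriv
        (by ring)
    refine HasDerivAt.congr_deriv (((hasDerivAt_rpow_mul_one_sub_rpow hy e a₁).mul (hDy.rpow_neg_const hD d)).mul_const
      (-((c₁ + 1) * z) * ((1 - x) ^ c₁ * (z ^ a₂ * (1 - z) ^ c₂)))) ?_
    have h1 : 1 - y ≠ 0 := by linarith [hy.2]
    simp only [kernel, withRatio, divY]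
    rw [rpow_add_one h1, rpow_add_one hy.1.ne']
    have := hD.ne'
    -- From `den = (1 - z) + x * y * z`; this is why `divY` can be written with the bounded ratio
    -- alone.
    have h5 : 1 - (1 - z) / den x y z = x * y * z / den x y z := by
      field_simp
      unfold den
      ring
    rw [h5]
    field_simp
    ring
  · intro x hx z hz
    have h3 : den x 0 z ≠ 0 := by
      have : 0 < 1 - z := by linarith [hz.2]
      unfold den; simpa using this.ne'
    refine ⟨(ContinuousAt.mul (ContinuousAt.mul ?_ ?_) ?_).mul continuousAt_const, ?_⟩
    · exact continuousAt_rpow_of_pos continuousAt_id h.neg_one_lt_e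
    · exact continuousAt_rpow_of_pos (by fun_prop) h.a₁_gt
    · exact continuousAt_den_rpow continuousAt_const continuousAt_id continuousAt_const h3
    · rw [zero_rpow (by linarith [h.neg_one_lt_e, h.neg_one_lt_c₂])]; simp
  · intro x hx z hz
    have h3 : den x 1 z ≠ 0 := by
      have : 0 < (1 - z) + x * z := add_pos (by linarith [hz.2]) (mul_pos hx.1 hz.1)
      unfold den; nlinarith
    refine ⟨(ContinuousAt.mul (ContinuousAt.mul ?_ ?_) ?_).mul continuousAt_const, ?_⟩
    · exact continuousAt_rpow_of_pos continuousAt_id h.neg_one_lt_e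
    · exact continuousAt_rpow_of_pos (by fun_prop) h.a₁_gt
    · exact continuousAt_den_rpow continuousAt_const continuousAt_id continuousAt_const h3
    · rw [sub_self, zero_rpow (by linarith [h.a₁_gt])]; simp

lemma Admissible.integral_divZ {a₁ a₂ c₁ c₂ e d η : ℝ} (h : Admissible a₁ a₂ c₁ c₂ e d η) :
    ∫ p, kernel a₁ a₂ c₁ c₂ e d p * divZ a₂ c₁ c₂ d (withRatio p) ∂cubeMeasure = 0 := by
  refine integral_cube_of_hasDerivAt_thd (h.integrable_mul (continuous_divZ a₂ c₁ c₂ d))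
    (fun x y z => (z ^ (a₂ + 1) * (1 - z) ^ (c₂ + 1)) * den x y z ^ (-d) *
      ((c₁ + 1) * ((1 - x) ^ c₁ * (y ^ e * (1 - y) ^ a₁)))) ?_ ?_ ?_
  · intro x hx y hy z hz
    have hD := den_pos hx hy hz
    have hDz : HasDerivAt (fun t => den x y t) (-(1 - x * y)) z := by
      unfold den
      exact (((hasDerivAt_id z).const_mul (1 - x * y)).const_sub 1).congr_deriv (by ring)
    refine HasDerivAt.congr_deriv (((hasDerivAt_rpow_mul_one_sub_rpow hz a₂ c₂).mul (hDz.rpow_neg_const hD d)).mul_const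
      ((c₁ + 1) * ((1 - x) ^ c₁ * (y ^ e * (1 - y) ^ a₁)))) ?_
    have h1 : 1 - z ≠ 0 := by linarith [hz.2]
    simp only [kernel, withRatio, divZ]
    rw [rpow_add_one h1, rpow_add_one hz.1.ne']
    have := hD.ne'
    field_simp
  · intro x hx y hy
    have h3 : den x y 0 ≠ 0 := by simp [den]
    refine ⟨(ContinuousAt.mul (ContinuousAt.mul ?_ ?_) ?_).mul continuousAt_const, ?_⟩
    · exact continuousAt_rpow_of_pos continuousAt_id h.a₂_gt
    · exact continuousAt_rpow_of_pos (by fun_prop) h.neg_one_lt_c₂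
    · exact continuousAt_den_rpow continuousAt_const continuousAt_const continuousAt_id h3
    · rw [zero_rpow (by linarith [h.a₂_gt])]; simp
  · intro x hx y hy
    have h3 : den x y 1 ≠ 0 := by
      have := mul_pos hx.1 hy.1
      simp [den, hx.1.ne', hy.1.ne']
    refine ⟨(ContinuousAt.mul (ContinuousAt.mul ?_ ?_) ?_).mul continuousAt_const, ?_⟩
    · exact continuousAt_rpow_of_pos continuousAt_id h.a₂_gt
    · exact continuousAt_rpow_of_pos (by fun_prop) h.neg_one_lt_c₂
    · exact continuousAt_den_rpow continuousAt_const continuousAt_const continuousAt_id h3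
    · rw [sub_self, zero_rpow (by linarith [h.neg_one_lt_e, h.neg_one_lt_c₂])]; simp

/-- The terms containing the ratio `(1 - z) / den` cancel because `1 - x * y = (1 - x) * y + (1 -
y)`. Among the others, `hc` kills the coefficient of `z` and simplifies the constant; what is left
is a constant and a multiple of `(1 - x) * y * z`, the factor that raises `c₁`, `e` and `a₂`. -/
lemma div_identity {a₁ a₂ c₁ c₂ e d : ℝ} (hc : c₂ = c₁ + a₁ - a₂) {p : ℝ × ℝ × ℝ}
    (hp : p ∈ unitCube) :
    divX a₁ c₁ e d (withRatio p) + divY a₁ c₁ e d (withRatio p) + divZ a₂ c₁ c₂ d (withRatio p) =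
      (2 + e + a₁ - d) * (2 + c₁ - d) * ((1 - p.1) * p.2.1 * p.2.2) -
        (2 + e + c₂ - d) * (c₁ + 1) := by
  obtain ⟨x, y, z⟩ := p
  obtain ⟨hx, hy, hz⟩ := hp
  have hD := (den_pos hx hy hz).ne'
  simp only [withRatio, divX, divY, divZ, hc] at hD ⊢
  field_simp
  unfold den
  ring

lemma kernel_shift {a₁ a₂ c₁ c₂ e d : ℝ} {p : ℝ × ℝ × ℝ} (hp : p ∈ unitCube) :
    kernel a₁ (a₂ + 1) (c₁ + 1) c₂ (e + 1) d p =
      kernel a₁ a₂ c₁ c₂ e d p * ((1 - p.1) * p.2.1 * p.2.2) := by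
  have h1 : 1 - p.1 ≠ 0 := by linarith [hp.1.2]
  simp only [kernel]
  rw [rpow_add_one h1, rpow_add_one hp.2.1.1.ne', rpow_add_one hp.2.2.1.ne']
  ring

lemma Admissible.shift {a₁ a₂ c₁ c₂ e d η : ℝ} (h : Admissible a₁ a₂ c₁ c₂ e d η) :
    Admissible a₁ (a₂ + 1) (c₁ + 1) c₂ (e + 1) d η :=
  ⟨h.nonneg, h.le_d, h.lt_one, by linarith [h.lt_e], h.lt_c, h.a₁_gt, by linarith [h.a₂_gt],
    by linarith [h.c₁_gt]⟩

/-- The contiguous relation obtained from a divergence identity; the only boundary contribution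
comes from the face `x = 0`. -/
lemma Admissible.contiguous {a₁ a₂ c₁ c₂ e d η : ℝ} (h : Admissible a₁ a₂ c₁ c₂ e d η)
    (hc : c₂ = c₁ + a₁ - a₂) :
    (2 + e + a₁ - d) * (2 + c₁ - d) * kernelIntegral a₁ (a₂ + 1) (c₁ + 1) c₂ (e + 1) d -
      (2 + e + c₂ - d) * (c₁ + 1) * kernelIntegral a₁ a₂ c₁ c₂ e d =
    -((3 + a₂ + e + c₂ - d) * (Gamma (e + 1) * Gamma (a₁ + 1) / Gamma (e + a₁ + 2) *
      (Gamma (a₂ + 1) * Gamma (c₂ + 2 - d) / Gamma (a₂ + c₂ + 3 - d)))) := by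
  have ix : Integrable (fun p => kernel a₁ a₂ c₁ c₂ e d p * divX a₁ c₁ e d (withRatio p))
    cubeMeasure := h.integrable_mul (continuous_divX a₁ c₁ e d)
  have iy : Integrable (fun p => kernel a₁ a₂ c₁ c₂ e d p * divY a₁ c₁ e d (withRatio p))
    cubeMeasure := h.integrable_mul (continuous_divY a₁ c₁ e d)
  have iz : Integrable (fun p => kernel a₁ a₂ c₁ c₂ e d p * divZ a₂ c₁ c₂ d (withRatio p))
    cubeMeasure := h.integrable_mul (continuous_divZ a₂ c₁ c₂ d)
  have hb : -1 < c₂ + 1 - d := by linarith [h.lt_c, h.lt_one]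
  have hbd : (3 + a₂ + e + c₂ - d) * (Gamma (e + 1) * Gamma (a₁ + 1) / Gamma (e + a₁ + 2) *
      (Gamma (a₂ + 1) * Gamma (c₂ + 2 - d) / Gamma (a₂ + c₂ + 3 - d))) =
      -∫ p, kernel a₁ a₂ c₁ c₂ e d p * divX a₁ c₁ e d (withRatio p) ∂cubeMeasure := by
    rw [h.integral_divX, integral_neg, neg_neg, integral_const_mul,
      integral_prod_mul (fun y : ℝ => y ^ e * (1 - y) ^ a₁)
        (fun z : ℝ => z ^ a₂ * (1 - z) ^ (c₂ + 1 - d)),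
      integral_beta h.neg_one_lt_e h.a₁_gt, integral_beta h.a₂_gt hb,
      show c₂ + 2 - d = c₂ + 1 - d + 1 by ring,
      show a₂ + c₂ + 3 - d = a₂ + (c₂ + 1 - d) + 2 by ring,
      show 3 + a₂ + e + c₂ - d = 3 + a₁ + e + c₁ - d by rw [hc]; ring]
  have hsplit := (integral_add (ix.add iy) iz).trans (congrArg (· + _) (integral_add ix iy))
  simp only [h.integral_divY, h.integral_divZ, add_zero] at hsplit
  rw [hbd, neg_neg, ← hsplit]
  unfold kernelIntegral
  rw [← integral_const_mul, ← integral_const_mul, ← integral_sub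
    (h.shift.integrable.const_mul _) (h.integrable.const_mul _)]
  refine integral_congr_ae ?_
  filter_upwards [ae_cubeMeasure_mem] with p hp
  simp only [Pi.add_apply]
  rw [kernel_shift hp, ← mul_add, ← mul_add, div_identity hc hp]
  ring

/-! ### The triple integral as a very-well-poised series -/

/-- The Gamma factor relating the triple integral to the very-well-poised series. -/
noncomputable def normConst (a₁ c₁ c₂ e d : ℝ) : ℝ :=
  Gamma (a₁ + 1) * Gamma (c₂ + 2 - d) * Gamma (2 + e + c₂ - d) * Gamma (c₁ + 1) /
    (Gamma (2 + e + a₁ - d) * Gamma (2 + c₁ - d))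

lemma Admissible.shift_nat {a₁ a₂ c₁ c₂ e d η : ℝ} (h : Admissible a₁ a₂ c₁ c₂ e d η) (n : ℕ) :
    Admissible a₁ (a₂ + n) (c₁ + n) c₂ (e + n) d η := by
  have := n.cast_nonneg (α := ℝ)
  exact ⟨h.nonneg, h.le_d, h.lt_one, by linarith [h.lt_e], h.lt_c, h.a₁_gt, by linarith [h.a₂_gt],
    by linarith [h.c₁_gt]⟩

lemma NonPole.add_nat {x : ℝ} (hx : NonPole x) (n : ℕ) : NonPole (x + n) := fun m h =>
  hx (n + m) (by push_cast; linarith)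

/-- `normConst` is chosen so that its ratio under the shift is the ratio of the two coefficients in
the contiguous relation. After division the relation is a plain difference, and the boundary term is
the first term of the series. -/
lemma Admissible.quotient_step {a₁ a₂ c₁ c₂ e d η : ℝ} (h : Admissible a₁ a₂ c₁ c₂ e d η)
    (hc : c₂ = c₁ + a₁ - a₂) (hE : NonPole (2 + e + a₁ - d)) (hF : NonPole (2 + c₁ - d)) :
    kernelIntegral a₁ a₂ c₁ c₂ e d / normConst a₁ c₁ c₂ e d -
      kernelIntegral a₁ (a₂ + 1) (c₁ + 1) c₂ (e + 1) d / normConst a₁ (c₁ + 1) c₂ (e + 1) d =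
    wpTerm (3 + a₂ + e + c₂ - d) (a₂ + 1) (e + 1) (2 + e + a₁ - d) (2 + c₁ - d) 0 := by
  have hcon := h.contiguous hc
  have hk : 0 < 2 + e + c₂ - d := by linarith [h.lt_e, h.lt_c]
  have hc1 : 0 < c₁ + 1 := by linarith [h.c₁_gt]
  have ha1 := (Gamma_pos_of_pos (show 0 < a₁ + 1 by linarith [h.a₁_gt])).ne'
  have hc2 := (Gamma_pos_of_pos (show 0 < c₂ + 2 - d by linarith [h.lt_c, h.lt_one])).ne'
  have hx1 := (Gamma_pos_of_pos (show 0 < e + a₁ + 2 by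
    linarith [h.neg_one_lt_e, h.a₁_gt])).ne'
  have hx2 := (Gamma_pos_of_pos (show 0 < a₂ + c₂ + 3 - d by
    linarith [h.lt_c, h.lt_one, h.a₂_gt])).ne'
  have hgk := (Gamma_pos_of_pos hk).ne'
  have hgc := (Gamma_pos_of_pos hc1).ne'
  have hgE := hE.Gamma_ne
  have hgF := hF.Gamma_ne
  have hE0 := hE.ne_zero
  have hF0 := hF.ne_zero
  have hN : normConst a₁ (c₁ + 1) c₂ (e + 1) d = normConst a₁ c₁ c₂ e d *
      ((2 + e + c₂ - d) * (c₁ + 1)) / ((2 + e + a₁ - d) * (2 + c₁ - d)) := by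
    rw [normConst, normConst, show 2 + (e + 1) + c₂ - d = (2 + e + c₂ - d) + 1 by ring,
      show 2 + (e + 1) + a₁ - d = (2 + e + a₁ - d) + 1 by ring,
      show 2 + (c₁ + 1) - d = (2 + c₁ - d) + 1 by ring, Gamma_add_one hk.ne',
      Gamma_add_one hE0, Gamma_add_one hF0, Gamma_add_one hc1.ne']
    field_simp
  have hN0 : normConst a₁ c₁ c₂ e d ≠ 0 :=
    div_ne_zero (by positivity) (mul_ne_zero hgE hgF)
  have hlhs : kernelIntegral a₁ a₂ c₁ c₂ e d / normConst a₁ c₁ c₂ e d -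
      kernelIntegral a₁ (a₂ + 1) (c₁ + 1) c₂ (e + 1) d / normConst a₁ (c₁ + 1) c₂ (e + 1) d =
      ((3 + a₂ + e + c₂ - d) * (Gamma (e + 1) * Gamma (a₁ + 1) / Gamma (e + a₁ + 2) *
      (Gamma (a₂ + 1) * Gamma (c₂ + 2 - d) / Gamma (a₂ + c₂ + 3 - d)))) /
      ((2 + e + c₂ - d) * (c₁ + 1) * normConst a₁ c₁ c₂ e d) := by
    rw [hN, ← neg_eq_iff_eq_neg.2 hcon]
    have := hk.ne'
    have := hc1.ne'
    field_simp
    ring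
  rw [hlhs, normConst, wpTerm, wpProd]
  simp only [CharP.cast_eq_zero, mul_zero, add_zero]
  rw [show 1 + (3 + a₂ + e + c₂ - d) - (a₂ + 1) = 2 + e + c₂ - d + 1 by ring,
    show 1 + (3 + a₂ + e + c₂ - d) - (e + 1) = a₂ + c₂ + 3 - d by ring,
    show 1 + (3 + a₂ + e + c₂ - d) - (2 + e + a₁ - d) = c₁ + 1 + 1 by rw [hc]; ring,
    show 1 + (3 + a₂ + e + c₂ - d) - (2 + c₁ - d) = e + a₁ + 2 by rw [hc]; ring,
    Gamma_add_one hk.ne', Gamma_add_one hc1.ne']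
  have := hk.ne'
  have := hc1.ne'
  field_simp

/-- Used twice: to recognise the step after `N` shifts as the `N`-th term of one series, and later
to read a series as the tail of a Dougall series. -/
lemma wpTerm_shift (A B C D E : ℝ) (n k : ℕ) :
    wpTerm (A + 2 * n) (B + n) (C + n) (D + n) (E + n) k = wpTerm A B C D E (k + n) := by
  have h (x : ℝ) : x + n + (k : ℝ) = x + ((k + n : ℕ) : ℝ) := by push_cast; ring
  have h' (x : ℝ) : 1 + (A + 2 * n) - (x + n) + (k : ℝ) = 1 + A - x + ((k + n : ℕ) : ℝ) := by
    push_cast; ring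
  simp only [wpTerm, wpProd, h, h']
  push_cast
  ring

lemma Admissible.sum_wpTerm {a₁ a₂ c₁ c₂ e d η : ℝ} (h : Admissible a₁ a₂ c₁ c₂ e d η)
    (hc : c₂ = c₁ + a₁ - a₂) (hE : NonPole (2 + e + a₁ - d)) (hF : NonPole (2 + c₁ - d)) (N : ℕ) :
    ∑ k ∈ Finset.range N,
      wpTerm (3 + a₂ + e + c₂ - d) (a₂ + 1) (e + 1) (2 + e + a₁ - d) (2 + c₁ - d) k =
    kernelIntegral a₁ a₂ c₁ c₂ e d / normConst a₁ c₁ c₂ e d -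
      kernelIntegral a₁ (a₂ + N) (c₁ + N) c₂ (e + N) d / normConst a₁ (c₁ + N) c₂ (e + N) d := by
  induction N with
  | zero => simp
  | succ N ih =>
    have hE' : NonPole (2 + (e + N) + a₁ - d) := by
      convert hE.add_nat N using 1; ring
    have hF' : NonPole (2 + (c₁ + N) - d) := by
      convert hF.add_nat N using 1; ring
    have hs := (h.shift_nat N).quotient_step (by rw [hc]; ring) hE' hF'
    rw [Finset.sum_range_succ, ih, ← zero_add N, ← wpTerm_shift, zero_add]
    push_cast
    rw [← add_assoc, ← add_assoc, ← add_assoc]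
    have e1 : 3 + (a₂ + (N : ℝ)) + (e + N) + c₂ - d = 3 + a₂ + e + c₂ - d + 2 * N := by ring
    have e2 : a₂ + (N : ℝ) + 1 = a₂ + 1 + N := by ring
    have e3 : e + (N : ℝ) + 1 = e + 1 + N := by ring
    have e4 : 2 + (e + (N : ℝ)) + a₁ - d = 2 + e + a₁ - d + N := by ring
    have e5 : 2 + (c₁ + (N : ℝ)) - d = 2 + c₁ - d + N := by ring
    rw [e1, e4, e5] at hs
    rw [← e2, ← e3, ← hs]
    ring

/-- The Gamma quotient bounding the remainder after `N` steps. -/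
noncomputable def remainderGamma (a₁ a₂ c₁ c₂ e d η : ℝ) (N : ℕ) : ℝ :=
  Gamma (2 + e + a₁ - d + N) / Gamma (2 + e + c₂ - d + N) *
    (Gamma (2 + c₁ - d + N) / Gamma (2 - η + c₁ + N)) *
    (Gamma (e - η + 1 + N) / Gamma (e - η + a₁ + 2 + N)) *
    (Gamma (a₂ + 1 + N) / Gamma (a₂ + (c₂ - d + η) + 2 + N))

lemma Admissible.nonPole_κ {a₁ a₂ c₁ c₂ e d η : ℝ} (h : Admissible a₁ a₂ c₁ c₂ e d η) :
    NonPole (2 + e + c₂ - d) := .of_pos (by linarith [h.lt_e, h.lt_c])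

/-- The four Gamma quotients decay together like `N ^ (-(2 * c₂ + 2))`; all other parameters, `η`
included, cancel from the exponent, and `c₂ > -1`. -/
lemma Admissible.tendsto_remainderGamma {a₁ a₂ c₁ c₂ e d η : ℝ}
    (h : Admissible a₁ a₂ c₁ c₂ e d η)
    (hE : NonPole (2 + e + a₁ - d)) (hF : NonPole (2 + c₁ - d)) :
    Tendsto (remainderGamma a₁ a₂ c₁ c₂ e d η) atTop (𝓝 0) := by
  have p1 : NonPole (2 - η + c₁) := .of_pos (by linarith [h.lt_one, h.c₁_gt])
  have p2 : NonPole (e - η + 1) := .of_pos (by linarith [h.lt_e])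
  have p3 : NonPole (e - η + a₁ + 2) := .of_pos (by linarith [h.lt_e, h.a₁_gt])
  have p4 : NonPole (a₂ + 1) := .of_pos (by linarith [h.a₂_gt])
  have p5 : NonPole (a₂ + (c₂ - d + η) + 2) := .of_pos (by linarith [h.a₂_gt, h.lt_c])
  have hlim := (((tendsto_Gamma_ratio hE h.nonPole_κ).mul (tendsto_Gamma_ratio hF p1)).mul
    (tendsto_Gamma_ratio p2 p3)).mul (tendsto_Gamma_ratio p4 p5)
  simp only [mul_one] at hlim
  have hf1 : Tendsto (fun N : ℕ => remainderGamma a₁ a₂ c₁ c₂ e d η N * (N : ℝ) ^ (2 * c₂ + 2))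
      atTop (𝓝 1) := by
    refine hlim.congr' ?_
    filter_upwards [eventually_gt_atTop 0] with n hn
    have hn' : (0 : ℝ) < n := by exact_mod_cast hn
    rw [show 2 * c₂ + 2 = (2 + e + c₂ - d - (2 + e + a₁ - d)) + (2 - η + c₁ - (2 + c₁ - d)) +
      (e - η + a₁ + 2 - (e - η + 1)) + (a₂ + (c₂ - d + η) + 2 - (a₂ + 1)) by ring,
      rpow_add hn', rpow_add hn', rpow_add hn', remainderGamma]
    ring
  simpa using tendsto_mul_rpow_zero (q := 0) hf1 (by linarith [h.neg_one_lt_c₂])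

lemma Admissible.abs_quotient_le {a₁ a₂ c₁ c₂ e d η : ℝ} (h : Admissible a₁ a₂ c₁ c₂ e d η)
    (hE : NonPole (2 + e + a₁ - d)) (hF : NonPole (2 + c₁ - d)) (N : ℕ) :
    ‖kernelIntegral a₁ (a₂ + N) (c₁ + N) c₂ (e + N) d / normConst a₁ (c₁ + N) c₂ (e + N) d‖ ≤
      |Gamma (-η + 1) * Gamma (c₂ - d + η + 1) / Gamma (c₂ + 2 - d) *
        remainderGamma a₁ a₂ c₁ c₂ e d η N| := by
  have hN := h.shift_nat N
  have h1 := hN.integral_le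
  have h2 := hN.integral_pos
  have hgc := (Gamma_pos_of_pos (show 0 < c₁ + N + 1 by linarith [hN.c₁_gt])).ne'
  have hga := (Gamma_pos_of_pos (show 0 < a₁ + 1 by linarith [h.a₁_gt])).ne'
  rw [norm_eq_abs, abs_div, abs_of_pos h2]
  refine (div_le_div_of_nonneg_right (h1.trans (le_abs_self _)) (abs_nonneg _)).trans_eq ?_
  rw [← abs_div]
  congr 1
  have e1 : -η + (c₁ + (N : ℝ)) + 2 = 2 - η + c₁ + N := by ring
  have e2 : e + (N : ℝ) - η + 1 = e - η + 1 + N := by ring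
  have e3 : e + (N : ℝ) - η + a₁ + 2 = e - η + a₁ + 2 + N := by ring
  have e4 : a₂ + (N : ℝ) + 1 = a₂ + 1 + N := by ring
  have e5 : a₂ + (N : ℝ) + (c₂ - d + η) + 2 = a₂ + (c₂ - d + η) + 2 + N := by ring
  have e6 : 2 + (e + (N : ℝ)) + c₂ - d = 2 + e + c₂ - d + N := by ring
  have e7 : 2 + (e + (N : ℝ)) + a₁ - d = 2 + e + a₁ - d + N := by ring
  have e8 : 2 + (c₁ + (N : ℝ)) - d = 2 + c₁ - d + N := by ring
  have g1 := hE.Gamma_nat_ne N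
  have g2 := hF.Gamma_nat_ne N
  have g3 := h.nonPole_κ.Gamma_nat_ne N
  rw [normConst, remainderGamma, e1, e2, e3, e4, e5, e6, e7, e8]
  generalize Gamma (2 + e + a₁ - d + N) = x1 at *
  generalize Gamma (2 + c₁ - d + N) = x2 at *
  generalize Gamma (2 + e + c₂ - d + N) = x3 at *
  generalize Gamma (c₁ + N + 1) = x4 at *
  generalize Gamma (a₁ + 1) = x5 at *
  clear h1 h2 hN h hE hF e1 e2 e3 e4 e5 e6 e7 e8
  field_simp

lemma Admissible.tendsto_quotient {a₁ a₂ c₁ c₂ e d η : ℝ} (h : Admissible a₁ a₂ c₁ c₂ e d η)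
    (hE : NonPole (2 + e + a₁ - d)) (hF : NonPole (2 + c₁ - d)) :
    Tendsto (fun N : ℕ => kernelIntegral a₁ (a₂ + N) (c₁ + N) c₂ (e + N) d /
      normConst a₁ (c₁ + N) c₂ (e + N) d) atTop (𝓝 0) := by
  have hf := ((h.tendsto_remainderGamma hE hF).const_mul
    (Gamma (-η + 1) * Gamma (c₂ - d + η + 1) / Gamma (c₂ + 2 - d))).abs
  rw [mul_zero, abs_zero] at hf
  exact squeeze_zero_norm (h.abs_quotient_le hE hF) hf

/-- The triple integral as a very-well-poised series. -/
theorem Admissible.tendsto_sum_wpTerm {a₁ a₂ c₁ c₂ e d η : ℝ} (h : Admissible a₁ a₂ c₁ c₂ e d η)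
    (hc : c₂ = c₁ + a₁ - a₂) (hE : NonPole (2 + e + a₁ - d)) (hF : NonPole (2 + c₁ - d)) :
    Tendsto (fun N : ℕ => ∑ k ∈ Finset.range N,
      wpTerm (3 + a₂ + e + c₂ - d) (a₂ + 1) (e + 1) (2 + e + a₁ - d) (2 + c₁ - d) k) atTop
      (𝓝 (kernelIntegral a₁ a₂ c₁ c₂ e d / normConst a₁ c₁ c₂ e d)) := by
  simp_rw [h.sum_wpTerm hc hE hF]
  simpa using (h.tendsto_quotient hE hF).const_sub
    (kernelIntegral a₁ a₂ c₁ c₂ e d / normConst a₁ c₁ c₂ e d)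

/-! ### A closed form of the integral, and Dougall's sum on a range -/

lemma image_moebius {t : ℝ} (ht : 0 < t) :
    (fun s : ℝ => s / (t * (1 - s) + s)) '' Ioo 0 1 = Ioo 0 1 := by
  ext z
  constructor
  · rintro ⟨s, hs, rfl⟩
    have h1 : 0 < t * (1 - s) := mul_pos ht (by linarith [hs.2])
    have h2 := hs.1
    refine ⟨by positivity, ?_⟩
    simp only
    rw [div_lt_one (by positivity)]
    linarith
  · rintro ⟨h0, h1⟩
    have h2 : 0 < 1 - z := by linarith
    have h3 : 0 < 1 - z + t * z := by positivity
    refine ⟨t * z / (1 - z + t * z), ⟨by positivity, ?_⟩, ?_⟩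
    · rw [div_lt_one h3]; linarith
    · have h4 : t * (1 - t * z / (1 - z + t * z)) + t * z / (1 - z + t * z) =
          t / (1 - z + t * z) := by
        field_simp; ring
      simp only [h4]
      field_simp

lemma injOn_moebius {t : ℝ} (ht : 0 < t) :
    InjOn (fun s : ℝ => s / (t * (1 - s) + s)) (Ioo 0 1) := by
  intro s hs r hr h
  have h1 : 0 < t * (1 - s) + s := add_pos (mul_pos ht (by linarith [hs.2])) hs.1
  have h2 : 0 < t * (1 - r) + r := add_pos (mul_pos ht (by linarith [hr.2])) hr.1
  simp only at h
  rw [div_eq_div_iff h1.ne' h2.ne'] at h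
  exact mul_left_cancel₀ ht.ne' (by linarith)

/-- The Euler integral with `d = a + c + 2`, evaluated by a Möbius substitution. -/
lemma integral_moebius {a c t : ℝ} (ht : 0 < t) (ha : -1 < a) (hc : -1 < c) :
    ∫ z, z ^ a * (1 - z) ^ c * (1 - (1 - t) * z) ^ (-(a + c + 2)) ∂unitMeasure =
      t ^ (-a - 1) * (Gamma (a + 1) * Gamma (c + 1) / Gamma (a + c + 2)) := by
  rw [← integral_beta ha hc, ← integral_const_mul]
  -- Under `z = s / (t * (1 - s) + s)` the exponent `-(a + c + 2)` is the one for which all powers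
  -- of `t * (1 - s) + s`, including the Jacobian's, cancel.
  have hsub := integral_image_eq_integral_abs_deriv_smul (s := Ioo (0 : ℝ) 1) measurableSet_Ioo
    (f := fun s : ℝ => s / (t * (1 - s) + s)) (f' := fun s => t / (t * (1 - s) + s) ^ 2) ?_
    (injOn_moebius ht) (fun z => z ^ a * (1 - z) ^ c * (1 - (1 - t) * z) ^ (-(a + c + 2)))
  · rw [image_moebius ht] at hsub
    rw [hsub]
    refine setIntegral_congr_fun measurableSet_Ioo fun s hs => ?_
    have h0 := hs.1
    have h1 : 0 < 1 - s := by linarith [hs.2]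
    have hq : 0 < t * (1 - s) + s := by positivity
    have e1 : 1 - s / (t * (1 - s) + s) = t * (1 - s) / (t * (1 - s) + s) := by
      field_simp; ring
    have e2 : 1 - (1 - t) * (s / (t * (1 - s) + s)) = t / (t * (1 - s) + s) := by
      field_simp; ring
    have e3 : |t / (t * (1 - s) + s) ^ 2| = t / (t * (1 - s) + s) ^ 2 :=
      abs_of_pos (by positivity)
    simp only [e1, e2, e3, smul_eq_mul]
    rw [div_rpow h0.le hq.le, div_rpow (by positivity) hq.le, div_rpow ht.le hq.le,
      mul_rpow ht.le h1.le, show -(a + c + 2) = -a - 1 + -(c : ℝ) + -1 by ring, rpow_add ht,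
      rpow_add ht, rpow_add hq, rpow_add hq, rpow_neg_one, rpow_neg_one, rpow_neg ht.le,
      rpow_neg hq.le, rpow_sub hq, rpow_neg hq.le, rpow_one]
    have := (rpow_pos_of_pos ht c).ne'
    have := (rpow_pos_of_pos hq c).ne'
    have := (rpow_pos_of_pos hq a).ne'
    field_simp
  · intro s hs
    have h1 : 0 < t * (1 - s) + s := add_pos (mul_pos ht (by linarith [hs.2])) hs.1
    refine (HasDerivAt.congr_deriv ((hasDerivAt_id s).div
      ((((hasDerivAt_id s).const_sub 1).const_mul t).add (hasDerivAt_id s)) h1.ne')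
      ?_).hasDerivWithinAt
    simp
    ring

/-- For `d = a₂ + c₂ + 2` the `z`-integral is a constant times `(x * y) ^ (-a₂ - 1)`, so the
variables separate. The hypotheses `a₂ < 0` and `a₂ < e` make the resulting beta integrals in `x`
and `y` converge. -/
lemma kernelIntegral_closed {a₁ a₂ c₁ c₂ e η : ℝ}
    (h : Admissible a₁ a₂ c₁ c₂ e (a₂ + c₂ + 2) η) (ha : a₂ < 0) (he : a₂ < e) :
    kernelIntegral a₁ a₂ c₁ c₂ e (a₂ + c₂ + 2) =
      Gamma (-a₂) * Gamma (c₁ + 1) / Gamma (c₁ - a₂ + 1) *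
      (Gamma (e - a₂) * Gamma (a₁ + 1) / Gamma (e - a₂ + a₁ + 1)) *
      (Gamma (a₂ + 1) * Gamma (c₂ + 1) / Gamma (a₂ + c₂ + 2)) := by
  have hX := integral_beta (p := -a₂ - 1) (q := c₁) (by linarith) h.c₁_gt
  have hY := integral_beta (p := e - a₂ - 1) (q := a₁) (by linarith) h.a₁_gt
  rw [show -a₂ - 1 + 1 = -a₂ by ring, show -a₂ - 1 + c₁ + 2 = c₁ - a₂ + 1 by ring] at hX
  rw [show e - a₂ - 1 + 1 = e - a₂ by ring,
    show e - a₂ - 1 + a₁ + 2 = e - a₂ + a₁ + 1 by ring] at hY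
  rw [kernelIntegral, integral_prod _ h.integrable, mul_assoc, ← hX, ← integral_mul_const]
  refine integral_congr_ae ?_
  filter_upwards [ae_restrict_mem measurableSet_Ioo, h.integrable.prod_right_ae] with x hx hi
  rw [integral_prod _ hi, ← hY, ← integral_mul_const, ← integral_const_mul]
  refine integral_congr_ae ?_
  filter_upwards [ae_restrict_mem measurableSet_Ioo] with y hy
  have hz := integral_moebius (mul_pos hx.1 hy.1) h.a₂_gt h.neg_one_lt_c₂
  simp only [kernel, den]
  simp_rw [mul_assoc ((1 - x) ^ c₁ * (y ^ e * (1 - y) ^ a₁))]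
  rw [integral_const_mul, hz, mul_rpow hx.1.le hy.1.le,
    show e - a₂ - 1 = e + (-a₂ - 1) by ring, rpow_add hy.1]
  ring

lemma wpTerm_swap (A B C D E : ℝ) (k : ℕ) : wpTerm A B C D E k = wpTerm A C B D E k := by
  simp only [wpTerm, wpProd]; ring

/-- Dougall's sum in the range where the triple integral is elementary. -/
lemma DougallSum.of_range {A B C D : ℝ} (hB : 0 < B) (hB1 : B < 1) (hBA : B < A) (hC : C < A)
    (hD : D < 1) (hs : 0 < 1 + A - B - C - D) (nC : NonPole C) (nD : NonPole D) :
    DougallSum A B C D := by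
  -- For the exponents chosen below, `d - c₂ - 1 = B`, `e + 1 = A` and `d = 1 + A - C - D`. Taking
  -- `e = A - 1` makes the parameter `e + 1` of the series equal its leading parameter.
  obtain ⟨η, h1, h2⟩ := exists_between
    (show B < min (min 1 A) (1 + A - C - D) from lt_min (lt_min hB1 hBA) (by linarith))
  have h3 := (lt_min_iff.1 (lt_min_iff.1 h2).1).1
  have h4 := (lt_min_iff.1 (lt_min_iff.1 h2).1).2
  have h5 := (lt_min_iff.1 h2).2
  have hd : 1 + A - C - D = (B - 1) + (A - C - D - B) + 2 := by ring
  have had : Admissible (-D) (B - 1) (A - 1 - C) (A - C - D - B) (A - 1)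
      ((B - 1) + (A - C - D - B) + 2) η :=
    ⟨by linarith, by linarith, h3, by linarith, by linarith, by linarith, by linarith,
      by linarith⟩
  have hval := kernelIntegral_closed had (by linarith) (by linarith)
  have eC : 2 + (A - 1) + -D - ((B - 1) + (A - C - D - B) + 2) = C := by ring
  have eD : 2 + (A - 1 - C) - ((B - 1) + (A - C - D - B) + 2) = D := by ring
  have hlim := had.tendsto_sum_wpTerm (by ring) (by rwa [eC]) (by rwa [eD])
  rw [eC, eD, hval, normConst, eC, eD] at hlim
  rw [show 3 + (B - 1) + (A - 1) + (A - C - D - B) - ((B - 1) + (A - C - D - B) + 2) = A by ring,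
    show B - 1 + 1 = B by ring, show A - 1 + 1 = A by ring, show -(B - 1) = 1 - B by ring,
    show A - 1 - C + 1 = A - C by ring, show A - 1 - C - (B - 1) + 1 = 1 + A - B - C by ring,
    show A - 1 - (B - 1) = A - B by ring, show A - B + -D + 1 = 1 + A - B - D by ring,
    show -D + 1 = 1 - D by ring, show A - C - D - B + 1 = 1 + A - B - C - D by ring, ← hd,
    show A - C - D - B + 2 - (1 + A - C - D) = 1 - B by ring,
    show 2 + (A - 1) + (A - C - D - B) - (1 + A - C - D) = A - B by ring] at hlim
  simp_rw [wpTerm_swap A B A C D] at hlim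
  unfold DougallSum
  convert hlim using 2
  have := (Gamma_pos_of_pos (show 0 < 1 - B by linarith)).ne'
  have := (Gamma_pos_of_pos (show 0 < A - B by linarith)).ne'
  have := (Gamma_pos_of_pos (show 0 < A - C by linarith)).ne'
  have := (Gamma_pos_of_pos (show 0 < 1 - D by linarith)).ne'
  have := nC.Gamma_ne
  have := nD.Gamma_ne
  rw [dougallValue]
  field_simp

/-! ### Parameters in sevenths -/

/-- The Gamma function at sevenths. -/
noncomputable def gammaSeventh (p : ℤ) : ℝ := Gamma ((p : ℝ) / 7)

lemma gammaSeventh_add_seven {p : ℤ} (hp : p ≠ 0) :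
    gammaSeventh (p + 7) = p / 7 * gammaSeventh p := by
  have : (p : ℝ) / 7 ≠ 0 := div_ne_zero (by exact_mod_cast hp) (by norm_num)
  rw [gammaSeventh, gammaSeventh, ← Gamma_add_one this]
  congr 1
  push_cast
  ring

lemma gammaSeventh_sub_seven {p : ℤ} (hp : p - 7 ≠ 0) :
    gammaSeventh (p - 7) = 7 / (p - 7) * gammaSeventh p := by
  have h := gammaSeventh_add_seven hp
  have h0 : (p : ℝ) - 7 ≠ 0 := by exact_mod_cast hp
  rw [sub_add_cancel] at h
  rw [h]
  push_cast
  field_simp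

lemma gammaSeventh_ne_zero {p : ℤ} (hp : ¬ (7 : ℤ) ∣ p) : gammaSeventh p ≠ 0 :=
  (NonPole.of_seventh hp).Gamma_ne

/-- Regularity of Dougall's sum at sevenths, as a decidable condition. -/
abbrev SeventhRegular (a b c d : ℤ) : Prop :=
  ¬ (7 : ℤ) ∣ a ∧ ¬ (7 : ℤ) ∣ b ∧ ¬ (7 : ℤ) ∣ c ∧ ¬ (7 : ℤ) ∣ d ∧ ¬ (7 : ℤ) ∣ 7 + a - b ∧
    ¬ (7 : ℤ) ∣ 7 + a - c ∧ ¬ (7 : ℤ) ∣ 7 + a - d ∧ ¬ (7 : ℤ) ∣ 7 + a - b - c ∧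
    ¬ (7 : ℤ) ∣ 7 + a - b - d ∧ ¬ (7 : ℤ) ∣ 7 + a - c - d

lemma SeventhRegular.regular {a b c d : ℤ} (h : SeventhRegular a b c d) :
    DougallRegular (a / 7) (b / 7) (c / 7) (d / 7) := by
  obtain ⟨h1, h2, h3, h4, h5, h6, h7, h8, h9, h10⟩ := h
  refine ⟨.of_seventh h1, .of_seventh h2, .of_seventh h3, .of_seventh h4, ?_, ?_, ?_, ?_, ?_, ?_⟩
  · convert NonPole.of_seventh h5 using 1; push_cast; ring
  · convert NonPole.of_seventh h6 using 1; push_cast; ring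
  · convert NonPole.of_seventh h7 using 1; push_cast; ring
  · convert NonPole.of_seventh h8 using 1; push_cast; ring
  · convert NonPole.of_seventh h9 using 1; push_cast; ring
  · convert NonPole.of_seventh h10 using 1; push_cast; ring

/-- Dougall's sum at sevenths. -/
def DougallSeventh (a b c d : ℤ) : Prop := DougallSum (a / 7) (b / 7) (c / 7) (d / 7)

lemma DougallSeventh.of_add_left {a a' b c d : ℤ} (h : DougallSeventh a' b c d) (ha : a' = a + 7)
    (hr : SeventhRegular a b c d) (hs : 0 < 7 + a - b - c - d) : DougallSeventh a b c d := by
  subst ha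
  have hs' : (0 : ℝ) < 7 + a - b - c - d := by exact_mod_cast hs
  refine DougallSum.of_add_one_left hr.regular (by linarith) ?_
  rw [DougallSeventh] at h
  convert h using 1
  push_cast; ring

lemma DougallSeventh.of_add_right {a b b' c d : ℤ} (h : DougallSeventh a b' c d) (hb : b' = b + 7)
    (hr : SeventhRegular a b c d) (hs : 0 < a - b - c - d) : DougallSeventh a b c d := by
  subst hb
  have hs' : (0 : ℝ) < a - b - c - d := by exact_mod_cast hs
  have h5 : a - b ≠ 0 := fun h0 => hr.2.2.2.2.1 ⟨1, by linarith⟩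
  have h8 : a - b - c ≠ 0 := fun h0 => hr.2.2.2.2.2.2.2.1 ⟨1, by linarith⟩
  have h9 : a - b - d ≠ 0 := fun h0 => hr.2.2.2.2.2.2.2.2.1 ⟨1, by linarith⟩
  refine DougallSum.of_add_one_right hr.regular ?_ ?_ ?_ (by linarith) ?_
  · have : (a : ℝ) - b ≠ 0 := by exact_mod_cast h5
    contrapose! this; linarith
  · have : (a : ℝ) - b - c ≠ 0 := by exact_mod_cast h8
    contrapose! this; linarith
  · have : (a : ℝ) - b - d ≠ 0 := by exact_mod_cast h9
    contrapose! this; linarith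
  · rw [DougallSeventh] at h
    convert h using 1
    push_cast; ring

lemma DougallSeventh.of_range {a b c d : ℤ} (hb : 0 < b) (hb7 : b < 7) (hba : b < a) (hc : c < a)
    (hd : d < 7) (hs : 0 < 7 + a - b - c - d) (nc : ¬ (7 : ℤ) ∣ c) (nd : ¬ (7 : ℤ) ∣ d) :
    DougallSeventh a b c d := by
  have hb' : (0 : ℝ) < b := by exact_mod_cast hb
  have hb7' : (b : ℝ) < 7 := by exact_mod_cast hb7
  have hba' : (b : ℝ) < a := by exact_mod_cast hba
  have hc' : (c : ℝ) < a := by exact_mod_cast hc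
  have hd' : (d : ℝ) < 7 := by exact_mod_cast hd
  have hs' : (0 : ℝ) < 7 + a - b - c - d := by exact_mod_cast hs
  exact DougallSum.of_range (by linarith) (by linarith) (by linarith) (by linarith) (by linarith)
    (by linarith) (.of_seventh nc) (.of_seventh nd)

/-- The very-well-poised term at sevenths. -/
noncomputable def wpSeventh (a b c d e : ℤ) : ℝ :=
  a / 7 * (gammaSeventh b / gammaSeventh (7 + a - b) *
    (gammaSeventh c / gammaSeventh (7 + a - c)) * (gammaSeventh d / gammaSeventh (7 + a - d)) *
    (gammaSeventh e / gammaSeventh (7 + a - e)))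

lemma wpTerm_seventh (a b c d e : ℤ) (k : ℕ) :
    wpTerm (a / 7) (b / 7) (c / 7) (d / 7) (e / 7) k =
      wpSeventh (a + 14 * k) (b + 7 * k) (c + 7 * k) (d + 7 * k) (e + 7 * k) := by
  have h1 (x : ℤ) : (x : ℝ) / 7 + k = ((x + 7 * k : ℤ) : ℝ) / 7 := by push_cast; ring
  have h2 (x : ℤ) : 1 + (a : ℝ) / 7 - x / 7 + k =
      ((7 + (a + 14 * k) - (x + 7 * k) : ℤ) : ℝ) / 7 := by push_cast; ring
  simp only [wpTerm, wpProd, wpSeventh, gammaSeventh, h1, h2]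
  push_cast
  ring

/-- Dougall's value at sevenths. -/
noncomputable def dougallSeventhValue (a b c d : ℤ) : ℝ :=
  gammaSeventh b * gammaSeventh c * gammaSeventh d * gammaSeventh (7 + a - b - c - d) /
    (gammaSeventh (7 + a - b - c) * gammaSeventh (7 + a - b - d) * gammaSeventh (7 + a - c - d))

lemma dougallValue_seventh (a b c d : ℤ) :
    dougallValue (a / 7) (b / 7) (c / 7) (d / 7) = dougallSeventhValue a b c d := by
  simp only [dougallValue, dougallSeventhValue, gammaSeventh]
  push_cast
  congr 4 <;> ring_nf

/-- The normalising Gamma factor at sevenths. -/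
noncomputable def normSeventh (a c d e : ℤ) : ℝ :=
  gammaSeventh (a + 7) * gammaSeventh (c + 14 - d) * gammaSeventh (14 + e + c - d) *
    gammaSeventh (c + 7) / (gammaSeventh (14 + e + a - d) * gammaSeventh (14 + c - d))

/-- Numerical conditions on the parameters, in sevenths, of an admissible integral. -/
abbrev SeventhAdmissible (a c d e : ℤ) : Prop :=
  0 ≤ d ∧ d - c - 7 < 7 ∧ d - c < e + 14 ∧ -7 < a ∧ -7 < c ∧ -7 < e

/-- If `d - c - 1` is negative, `η = 0` works; otherwise a value lies strictly between it and the
minimum of `1`, `e + 1` and `d`. -/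
lemma SeventhAdmissible.exists_admissible {a c d e : ℤ} (h : SeventhAdmissible a c d e) :
    ∃ η, Admissible (a / 7) (a / 7) (c / 7) (c / 7) (e / 7) (d / 7) η := by
  obtain ⟨h1, h2, h3, h4, h5, h6⟩ := h
  have h1' : (0 : ℝ) ≤ d := by exact_mod_cast h1
  have h2' : (d : ℝ) - c - 7 < 7 := by exact_mod_cast h2
  have h3' : (d : ℝ) - c < e + 14 := by exact_mod_cast h3
  have h4' : (-7 : ℝ) < a := by exact_mod_cast h4
  have h5' : (-7 : ℝ) < c := by exact_mod_cast h5
  have h6' : (-7 : ℝ) < e := by exact_mod_cast h6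
  rcases lt_or_ge ((d : ℝ) / 7 - c / 7 - 1) 0 with h | h
  · exact ⟨0, le_rfl, by linarith, by norm_num, by linarith, h, by linarith, by linarith,
      by linarith⟩
  · obtain ⟨η, g1, g2⟩ := exists_between
      (show (d : ℝ) / 7 - c / 7 - 1 < min (min 1 ((e : ℝ) / 7 + 1)) (d / 7) from
        lt_min (lt_min (by linarith) (by linarith)) (by linarith))
    have g3 := (lt_min_iff.1 (lt_min_iff.1 g2).1).1
    have g4 := (lt_min_iff.1 (lt_min_iff.1 g2).1).2
    have g5 := (lt_min_iff.1 g2).2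
    exact ⟨η, by linarith, by linarith, g3, g4, g1, by linarith, by linarith, by linarith⟩

/-- Moving the start of the series back by `m` lowers its leading parameter by `2 * m` and the
others by `m`. `hAB` says that the leading one then meets the parameter coming from `a` or from `e`,
so the integral sums a Dougall series from index `m` on. In sevenths this means `14 + e + c - d = 7
* m` or `14 + a + c - d = 7 * m`. -/
lemma kernelIntegral_eq_of_dougall {a c d e : ℤ} (h : SeventhAdmissible a c d e)
    (hE : ¬ (7 : ℤ) ∣ 14 + e + a - d) (hF : ¬ (7 : ℤ) ∣ 14 + c - d) {A B C D : ℤ} (m : ℕ)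
    (hA : A = 21 + a + e + c - d - 14 * m) (hC : C = 14 + e + a - d - 7 * m)
    (hD : D = 14 + c - d - 7 * m)
    (hAB : (A = a + 7 - 7 * m ∧ B = e + 7 - 7 * m) ∨ (A = e + 7 - 7 * m ∧ B = a + 7 - 7 * m))
    (hS : DougallSeventh A B C D) :
    kernelIntegral (a / 7) (a / 7) (c / 7) (c / 7) (e / 7) (d / 7) =
      normSeventh a c d e * (dougallSeventhValue A B C D - ∑ k ∈ Finset.range m,
        wpSeventh (A + 14 * k) (A + 7 * k) (B + 7 * k) (C + 7 * k) (D + 7 * k)) := by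
  obtain ⟨η, had⟩ := h.exists_admissible
  have eE : (2 : ℝ) + e / 7 + a / 7 - d / 7 = ((14 + e + a - d : ℤ) : ℝ) / 7 := by push_cast; ring
  have eF : (2 : ℝ) + c / 7 - d / 7 = ((14 + c - d : ℤ) : ℝ) / 7 := by push_cast; ring
  have hlim := had.tendsto_sum_wpTerm (by ring) (by rw [eE]; exact .of_seventh hE)
    (by rw [eF]; exact .of_seventh hF)
  have hnorm : normConst (a / 7) (c / 7) (c / 7) (e / 7) (d / 7) = normSeventh a c d e := by
    simp only [normConst, normSeventh, gammaSeventh]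
    push_cast
    congr 4 <;> ring_nf
  have hn0 : normSeventh a c d e ≠ 0 := by
    rw [← hnorm, normConst, eE, eF]
    have p1 := Gamma_pos_of_pos (show (0 : ℝ) < a / 7 + 1 by linarith [had.a₁_gt])
    have p2 := Gamma_pos_of_pos (show (0 : ℝ) < c / 7 + 2 - d / 7 by
      linarith [had.lt_c, had.lt_one])
    have p3 := had.nonPole_κ.Gamma_ne
    have p4 := Gamma_pos_of_pos (show (0 : ℝ) < c / 7 + 1 by linarith [had.c₁_gt])
    exact div_ne_zero (mul_ne_zero (mul_ne_zero (mul_ne_zero p1.ne' p2.ne') p3) p4.ne')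
      (mul_ne_zero (gammaSeventh_ne_zero hE) (gammaSeventh_ne_zero hF))
  have hterm (k : ℕ) : wpTerm (3 + a / 7 + e / 7 + c / 7 - d / 7) (a / 7 + 1) (e / 7 + 1)
      (2 + e / 7 + a / 7 - d / 7) (2 + c / 7 - d / 7) k =
      wpTerm (A / 7) (A / 7) (B / 7) (C / 7) (D / 7) (k + m) := by
    rw [← wpTerm_shift]
    have hA' : (A : ℝ) = 21 + a + e + c - d - 14 * m := by exact_mod_cast hA
    have hC' : (C : ℝ) = 14 + e + a - d - 7 * m := by exact_mod_cast hC
    have hD' : (D : ℝ) = 14 + c - d - 7 * m := by exact_mod_cast hD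
    have e1 : (3 : ℝ) + a / 7 + e / 7 + c / 7 - d / 7 = A / 7 + 2 * m := by linarith
    have e2 : (2 : ℝ) + e / 7 + a / 7 - d / 7 = C / 7 + m := by linarith
    have e3 : (2 : ℝ) + c / 7 - d / 7 = D / 7 + m := by linarith
    rw [e1, e2, e3]
    rcases hAB with ⟨h1, h2⟩ | ⟨h1, h2⟩
    · have h1' : (A : ℝ) = a + 7 - 7 * m := by exact_mod_cast h1
      have h2' : (B : ℝ) = e + 7 - 7 * m := by exact_mod_cast h2
      rw [show (a : ℝ) / 7 + 1 = A / 7 + m by linarith,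
        show (e : ℝ) / 7 + 1 = B / 7 + m by linarith]
    · have h1' : (A : ℝ) = e + 7 - 7 * m := by exact_mod_cast h1
      have h2' : (B : ℝ) = a + 7 - 7 * m := by exact_mod_cast h2
      rw [show (a : ℝ) / 7 + 1 = B / 7 + m by linarith,
        show (e : ℝ) / 7 + 1 = A / 7 + m by linarith, wpTerm_swap]
  simp_rw [hterm] at hlim
  have hS' : Tendsto (fun N : ℕ => ∑ k ∈ Finset.range N,
      wpTerm (A / 7) (A / 7) (B / 7) (C / 7) (D / 7) (k + m)) atTop
      (𝓝 (dougallSeventhValue A B C D - ∑ k ∈ Finset.range m,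
        wpTerm (A / 7) (A / 7) (B / 7) (C / 7) (D / 7) k)) := by
    rw [← dougallValue_seventh]
    refine (((tendsto_add_atTop_iff_nat m).2 hS).sub_const _).congr fun N => ?_
    rw [add_comm N m, Finset.sum_range_add]
    simp_rw [add_comm m]
    ring
  have hv := tendsto_nhds_unique hlim hS'
  rw [hnorm, div_eq_iff hn0] at hv
  rw [hv, mul_comm]
  simp_rw [wpTerm_seventh]

/-- No numerical estimate of the denominator `v` is needed: since the integral at `d` is positive,
`v = 0` would force `u = 0`, which `huv` excludes. -/
lemma kHasValue_of_mul_eq {a c d e : ℤ} (h : SeventhAdmissible a c d e)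
    (h' : SeventhAdmissible a c (d + 7) e) {u v : ℝ} (huv : u = 0 → v ≠ 0)
    (hK : kernelIntegral (a / 7) (a / 7) (c / 7) (c / 7) (e / 7) ((d + 7 : ℤ) / 7) * v =
      u * kernelIntegral (a / 7) (a / 7) (c / 7) (c / 7) (e / 7) (d / 7)) :
    KHasValue (a / 7) 0 (c / 7) (d / 7) (e / 7) (u / v) := by
  obtain ⟨η, had⟩ := h.exists_admissible
  obtain ⟨η', had'⟩ := h'.exists_admissible
  have ed : ((d + 7 : ℤ) : ℝ) / 7 = (d : ℝ) / 7 + 1 := by push_cast; ring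
  rw [ed] at had' hK
  have hpos := had.integral_pos.ne'
  have hv : v ≠ 0 := fun hv => by
    rw [hv, mul_zero, eq_comm, mul_eq_zero] at hK
    exact huv (hK.resolve_right hpos) hv
  refine ⟨had'.J3Converges, had.J3Converges, by rwa [J3_eq_kernelIntegral], ?_⟩
  rw [K, J3_eq_kernelIntegral, J3_eq_kernelIntegral, div_eq_div_iff hpos hv, hK]

/-! ### Reduction to Gamma at `1/7, …, 6/7` -/

lemma gammaSeventh_7 : gammaSeventh 7 = 1 := by
  rw [gammaSeventh, show (((7 : ℤ) : ℝ) / 7) = ((0 : ℕ) : ℝ) + 1 by norm_num, Gamma_nat_eq_factorial]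
  norm_num [Nat.factorial]

lemma gammaSeventh_neg_1 : gammaSeventh (-1) = -(7) * gammaSeventh 6 := by
  rw [show (-1 : ℤ) = 6 - 7 by rfl, gammaSeventh_sub_seven (by decide)]
  push_cast; ring

lemma gammaSeventh_8 : gammaSeventh (8) = 1/7 * gammaSeventh 1 := by
  rw [show (8 : ℤ) = 1 + 7 by rfl, gammaSeventh_add_seven (by decide)]
  push_cast; ring

lemma gammaSeventh_neg_2 : gammaSeventh (-2) = -(7/2) * gammaSeventh 5 := by
  rw [show (-2 : ℤ) = 5 - 7 by rfl, gammaSeventh_sub_seven (by decide)]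
  push_cast; ring

lemma gammaSeventh_9 : gammaSeventh (9) = 2/7 * gammaSeventh 2 := by
  rw [show (9 : ℤ) = 2 + 7 by rfl, gammaSeventh_add_seven (by decide)]
  push_cast; ring

lemma gammaSeventh_neg_3 : gammaSeventh (-3) = -(7/3) * gammaSeventh 4 := by
  rw [show (-3 : ℤ) = 4 - 7 by rfl, gammaSeventh_sub_seven (by decide)]
  push_cast; ring

lemma gammaSeventh_10 : gammaSeventh (10) = 3/7 * gammaSeventh 3 := by
  rw [show (10 : ℤ) = 3 + 7 by rfl, gammaSeventh_add_seven (by decide)]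
  push_cast; ring

lemma gammaSeventh_neg_4 : gammaSeventh (-4) = -(7/4) * gammaSeventh 3 := by
  rw [show (-4 : ℤ) = 3 - 7 by rfl, gammaSeventh_sub_seven (by decide)]
  push_cast; ring

lemma gammaSeventh_11 : gammaSeventh (11) = 4/7 * gammaSeventh 4 := by
  rw [show (11 : ℤ) = 4 + 7 by rfl, gammaSeventh_add_seven (by decide)]
  push_cast; ring

lemma gammaSeventh_neg_5 : gammaSeventh (-5) = -(7/5) * gammaSeventh 2 := by
  rw [show (-5 : ℤ) = 2 - 7 by rfl, gammaSeventh_sub_seven (by decide)]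
  push_cast; ring

lemma gammaSeventh_12 : gammaSeventh (12) = 5/7 * gammaSeventh 5 := by
  rw [show (12 : ℤ) = 5 + 7 by rfl, gammaSeventh_add_seven (by decide)]
  push_cast; ring

lemma gammaSeventh_neg_6 : gammaSeventh (-6) = -(7/6) * gammaSeventh 1 := by
  rw [show (-6 : ℤ) = 1 - 7 by rfl, gammaSeventh_sub_seven (by decide)]
  push_cast; ring

lemma gammaSeventh_13 : gammaSeventh (13) = 6/7 * gammaSeventh 6 := by
  rw [show (13 : ℤ) = 6 + 7 by rfl, gammaSeventh_add_seven (by decide)]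
  push_cast; ring

lemma gammaSeventh_14 : gammaSeventh 14 = 1 := by
  rw [gammaSeventh, show (((14 : ℤ) : ℝ) / 7) = ((1 : ℕ) : ℝ) + 1 by norm_num, Gamma_nat_eq_factorial]
  norm_num [Nat.factorial]

lemma gammaSeventh_neg_9 : gammaSeventh (-9) = 49/18 * gammaSeventh 5 := by
  rw [show (-9 : ℤ) = -2 - 7 by rfl, gammaSeventh_sub_seven (by decide), gammaSeventh_neg_2]
  push_cast; ring

lemma gammaSeventh_16 : gammaSeventh (16) = 18/49 * gammaSeventh 2 := by
  rw [show (16 : ℤ) = 9 + 7 by rfl, gammaSeventh_add_seven (by decide), gammaSeventh_9]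
  push_cast; ring

lemma gammaSeventh_17 : gammaSeventh (17) = 30/49 * gammaSeventh 3 := by
  rw [show (17 : ℤ) = 10 + 7 by rfl, gammaSeventh_add_seven (by decide), gammaSeventh_10]
  push_cast; ring

lemma gammaSeventh_18 : gammaSeventh (18) = 44/49 * gammaSeventh 4 := by
  rw [show (18 : ℤ) = 11 + 7 by rfl, gammaSeventh_add_seven (by decide), gammaSeventh_11]
  push_cast; ring

lemma gammaSeventh_neg_13 : gammaSeventh (-13) = 49/78 * gammaSeventh 1 := by
  rw [show (-13 : ℤ) = -6 - 7 by rfl, gammaSeventh_sub_seven (by decide), gammaSeventh_neg_6]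
  push_cast; ring

lemma gammaSeventh_21 : gammaSeventh 21 = 2 := by
  rw [gammaSeventh, show (((21 : ℤ) : ℝ) / 7) = ((2 : ℕ) : ℝ) + 1 by norm_num, Gamma_nat_eq_factorial]
  norm_num [Nat.factorial]

lemma DougallSeventh.swap {a b c d : ℤ} (h : DougallSeventh a b c d) : DougallSeventh a c b d := by
  have e : dougallSeventhValue a c b d = dougallSeventhValue a b c d := by
    simp only [dougallSeventhValue]
    rw [show 7 + a - c - b - d = 7 + a - b - c - d by ring,
      show 7 + a - c - b = 7 + a - b - c by ring]
    ring
  unfold DougallSeventh DougallSum at *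
  rw [dougallValue_seventh, e, ← dougallValue_seventh]
  refine h.congr fun N => Finset.sum_congr rfl fun k _ => ?_
  simp only [wpTerm, wpProd]
  ring

/-! ### The four constants in terms of Gamma at sevenths -/

/-- Legendre duplication at `1/7` removes `Γ(9/14)`, and reflection at `2/7` removes the cosine, as
`sin (2π/7) = cos (3π/14)`. -/
lemma K5_eq : K5 = 2 * gammaSeventh 2 ^ 2 * gammaSeventh 5 /
    (gammaSeventh 1 * gammaSeventh 4 ^ 2) := by
  have h1 : gammaSeventh 1 * Gamma (9 / 14) = gammaSeventh 2 * 2 ^ (5 / 7 : ℝ) * √π := by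
    have h := Gamma_mul_Gamma_add_half (1 / 7)
    norm_num at h
    simpa [gammaSeventh] using h
  have h2 : gammaSeventh 2 * gammaSeventh 5 = π / cos (3 * π / 14) := by
    have h := Gamma_mul_Gamma_one_sub (2 / 7)
    rw [show π * (2 / 7) = π / 2 - 3 * π / 14 by ring, sin_pi_div_two_sub] at h
    norm_num at h
    simpa [gammaSeventh] using h
  have h3 : Gamma (4 / 7) = gammaSeventh 4 := by simp [gammaSeventh]
  have g1 : gammaSeventh 1 ≠ 0 := gammaSeventh_ne_zero (by decide)
  have g4 : gammaSeventh 4 ≠ 0 := gammaSeventh_ne_zero (by decide)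
  have hc : cos (3 * π / 14) ≠ 0 :=
    (cos_pos_of_mem_Ioo ⟨by linarith [pi_pos], by linarith [pi_pos]⟩).ne'
  have h5 : Gamma (9 / 14) = gammaSeventh 2 * 2 ^ (5 / 7 : ℝ) * √π / gammaSeventh 1 := by
    rw [← h1]; field_simp
  have h6 : (2 : ℝ) ^ (2 / 7 : ℝ) * 2 ^ (5 / 7 : ℝ) = 2 := by
    rw [← rpow_add two_pos]; norm_num
  have h7 : √π * √π = π := mul_self_sqrt pi_pos.le
  have h8 : 2 * gammaSeventh 2 ^ 2 * gammaSeventh 5 / (gammaSeventh 1 * gammaSeventh 4 ^ 2) =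
      2 * gammaSeventh 2 * (gammaSeventh 2 * gammaSeventh 5) /
        (gammaSeventh 1 * gammaSeventh 4 ^ 2) := by ring
  rw [h8, h2, K5, h5, h3]
  calc _ = (2 ^ (2 / 7 : ℝ) * 2 ^ (5 / 7 : ℝ)) * gammaSeventh 2 * (√π * √π) /
        (cos (3 * π / 14) * gammaSeventh 1 * gammaSeventh 4 ^ 2) := by
        field_simp
    _ = _ := by
        rw [h6, h7]
        field_simp

lemma L1_eq : L1 = gammaSeventh 2 ^ 2 * gammaSeventh 4 /
    (gammaSeventh 1 ^ 2 * gammaSeventh 6) := by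
  simp [L1, gammaSeventh]

lemma L2_eq : L2 = gammaSeventh 3 ^ 2 * gammaSeventh 6 /
    (gammaSeventh 2 * gammaSeventh 5 ^ 2) := by
  simp [L2, gammaSeventh]

lemma L3_eq : L3 = gammaSeventh 3 * gammaSeventh 4 ^ 2 /
    (gammaSeventh 1 ^ 2 * gammaSeventh 2) := by
  simp [L3, gammaSeventh]

/-! ### The four evaluations -/

/-- The leading parameter is negative, outside the range of the integral proof; the sum starts from
a nearby point of that range and descends by whole units. The later instances follow the same
pattern. -/
lemma dougallSeventh_neg3_neg6_2_neg1 : DougallSeventh (-3) (-6) 2 (-1) := by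
  have h : DougallSeventh 4 2 (-6) (-1) := .of_range (by decide) (by decide) (by decide) (by decide)
    (by decide) (by decide) (by decide) (by decide)
  replace h : DougallSeventh (-3) 2 (-6) (-1) := h.of_add_left (by decide) (by decide) (by decide)
  exact h.swap

lemma dougallSeventh_4_1_2_neg1 : DougallSeventh 4 1 2 (-1) := by
  have h : DougallSeventh 4 1 2 (-1) := .of_range (by decide) (by decide) (by decide) (by decide)
    (by decide) (by decide) (by decide) (by decide)
  exact h

lemma kHasValue_two_three_four : KHasValue (1 / 7) 0 (2 / 7) (3 / 7) (4 / 7)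
    (-(189 * (8 - 5 * K5)) / (832 - 525 * K5)) := by
  -- Here `a + c - d = 0`, so two initial Dougall terms are missing; raising `d` by one leaves only
  -- one missing.
  have h0 := kernelIntegral_eq_of_dougall (a := 1) (c := 2) (d := 3) (e := 4) (by decide)
    (by decide) (by decide) 2 rfl rfl rfl (by decide) dougallSeventh_neg3_neg6_2_neg1
  have h1 := kernelIntegral_eq_of_dougall (a := 1) (c := 2) (d := 10) (e := 4) (by decide)
    (by decide) (by decide) 1 rfl rfl rfl (by decide) dougallSeventh_4_1_2_neg1
  have g1 : gammaSeventh 1 ≠ 0 := gammaSeventh_ne_zero (by decide)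
  have g2 : gammaSeventh 2 ≠ 0 := gammaSeventh_ne_zero (by decide)
  have g3 : gammaSeventh 3 ≠ 0 := gammaSeventh_ne_zero (by decide)
  have g4 : gammaSeventh 4 ≠ 0 := gammaSeventh_ne_zero (by decide)
  have g5 : gammaSeventh 5 ≠ 0 := gammaSeventh_ne_zero (by decide)
  have g6 : gammaSeventh 6 ≠ 0 := gammaSeventh_ne_zero (by decide)
  have key := kHasValue_of_mul_eq (a := 1) (c := 2) (d := 3) (e := 4) (by decide) (by decide)
    -- Both vanishing would give `525 * K5 = 840` and `525 * K5 = 832`.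
    (u := -(189 * (8 - 5 * K5))) (v := 832 - 525 * K5) (fun hu hv => by linarith) ?_
  · simpa using key
  · rw [show (3 : ℤ) + 7 = 10 from rfl, h0, h1, K5_eq]
    simp only [normSeventh, dougallSeventhValue, wpSeventh, Finset.sum_range_succ,
      Finset.sum_range_zero, Nat.cast_zero, Nat.cast_one, Nat.cast_ofNat]
    norm_num only
    -- Once all arguments lie in `1/7, …, 6/7`, the claim is a rational identity in the six Gamma
    -- values; no reflection relation between them is used.
    simp only [gammaSeventh_neg_6, gammaSeventh_neg_3, gammaSeventh_neg_1, gammaSeventh_7, gammaSeventh_8, gammaSeventh_9, gammaSeventh_10, gammaSeventh_11, gammaSeventh_12, gammaSeventh_13, gammaSeventh_14, gammaSeventh_16, gammaSeventh_17]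
    field_simp
    ring

lemma dougallSeventh_neg6_neg4_neg1_neg3 : DougallSeventh (-6) (-4) (-1) (-3) := by
  have h : DougallSeventh 8 3 (-1) (-3) := .of_range (by decide) (by decide) (by decide) (by decide)
    (by decide) (by decide) (by decide) (by decide)
  replace h : DougallSeventh 8 (-4) (-1) (-3) := h.of_add_right (by decide) (by decide) (by decide)
  replace h : DougallSeventh 1 (-4) (-1) (-3) := h.of_add_left (by decide) (by decide) (by decide)
  replace h : DougallSeventh (-6) (-4) (-1) (-3) := h.of_add_left (by decide) (by decide) (by decide)
  exact h

lemma dougallSeventh_1_3_neg1_neg3 : DougallSeventh 1 3 (-1) (-3) := by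
  have h : DougallSeventh 8 3 (-1) (-3) := .of_range (by decide) (by decide) (by decide) (by decide)
    (by decide) (by decide) (by decide) (by decide)
  replace h : DougallSeventh 1 3 (-1) (-3) := h.of_add_left (by decide) (by decide) (by decide)
  exact h

lemma kHasValue_two_five_three : KHasValue (1 / 7) 0 (2 / 7) (5 / 7) (3 / 7)
    (-(3 * (5 - 16 * L1)) / (23 - 70 * L1)) := by
  -- Now `e + c - d = 0`: the parameter from `a` is the one that meets the leading parameter.
  have h0 := kernelIntegral_eq_of_dougall (a := 1) (c := 2) (d := 5) (e := 3) (by decide)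
    (by decide) (by decide) 2 rfl rfl rfl (by decide) dougallSeventh_neg6_neg4_neg1_neg3
  have h1 := kernelIntegral_eq_of_dougall (a := 1) (c := 2) (d := 12) (e := 3) (by decide)
    (by decide) (by decide) 1 rfl rfl rfl (by decide) dougallSeventh_1_3_neg1_neg3
  have g1 : gammaSeventh 1 ≠ 0 := gammaSeventh_ne_zero (by decide)
  have g2 : gammaSeventh 2 ≠ 0 := gammaSeventh_ne_zero (by decide)
  have g3 : gammaSeventh 3 ≠ 0 := gammaSeventh_ne_zero (by decide)
  have g4 : gammaSeventh 4 ≠ 0 := gammaSeventh_ne_zero (by decide)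
  have g5 : gammaSeventh 5 ≠ 0 := gammaSeventh_ne_zero (by decide)
  have g6 : gammaSeventh 6 ≠ 0 := gammaSeventh_ne_zero (by decide)
  have key := kHasValue_of_mul_eq (a := 1) (c := 2) (d := 5) (e := 3) (by decide) (by decide)
    (u := -(3 * (5 - 16 * L1))) (v := 23 - 70 * L1) (fun hu hv => by linarith) ?_
  · simpa using key
  · rw [show (5 : ℤ) + 7 = 12 from rfl, h0, h1, L1_eq]
    simp only [normSeventh, dougallSeventhValue, wpSeventh, Finset.sum_range_succ,
      Finset.sum_range_zero, Nat.cast_zero, Nat.cast_one, Nat.cast_ofNat]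
    norm_num only
    simp only [gammaSeventh_neg_6, gammaSeventh_neg_4, gammaSeventh_neg_3, gammaSeventh_neg_1, gammaSeventh_7, gammaSeventh_8, gammaSeventh_9, gammaSeventh_11, gammaSeventh_12, gammaSeventh_13, gammaSeventh_14]
    field_simp
    ring

lemma dougallSeventh_neg2_neg6_2_neg1 : DougallSeventh (-2) (-6) 2 (-1) := by
  have h : DougallSeventh 5 2 (-6) (-1) := .of_range (by decide) (by decide) (by decide) (by decide)
    (by decide) (by decide) (by decide) (by decide)
  replace h : DougallSeventh (-2) 2 (-6) (-1) := h.of_add_left (by decide) (by decide) (by decide)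
  exact h.swap

lemma dougallSeventh_5_1_2_neg1 : DougallSeventh 5 1 2 (-1) := by
  have h : DougallSeventh 5 1 2 (-1) := .of_range (by decide) (by decide) (by decide) (by decide)
    (by decide) (by decide) (by decide) (by decide)
  exact h

lemma kHasValue_three_four_five : KHasValue (1 / 7) 0 (3 / 7) (4 / 7) (5 / 7)
    (-(21 * (25 - 27 * L2)) / (425 - 462 * L2)) := by
  have h0 := kernelIntegral_eq_of_dougall (a := 1) (c := 3) (d := 4) (e := 5) (by decide)
    (by decide) (by decide) 2 rfl rfl rfl (by decide) dougallSeventh_neg2_neg6_2_neg1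
  have h1 := kernelIntegral_eq_of_dougall (a := 1) (c := 3) (d := 11) (e := 5) (by decide)
    (by decide) (by decide) 1 rfl rfl rfl (by decide) dougallSeventh_5_1_2_neg1
  have g1 : gammaSeventh 1 ≠ 0 := gammaSeventh_ne_zero (by decide)
  have g2 : gammaSeventh 2 ≠ 0 := gammaSeventh_ne_zero (by decide)
  have g3 : gammaSeventh 3 ≠ 0 := gammaSeventh_ne_zero (by decide)
  have g4 : gammaSeventh 4 ≠ 0 := gammaSeventh_ne_zero (by decide)
  have g5 : gammaSeventh 5 ≠ 0 := gammaSeventh_ne_zero (by decide)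
  have g6 : gammaSeventh 6 ≠ 0 := gammaSeventh_ne_zero (by decide)
  have key := kHasValue_of_mul_eq (a := 1) (c := 3) (d := 4) (e := 5) (by decide) (by decide)
    (u := -(21 * (25 - 27 * L2))) (v := 425 - 462 * L2) (fun hu hv => by linarith) ?_
  · simpa using key
  · rw [show (4 : ℤ) + 7 = 11 from rfl, h0, h1, L2_eq]
    simp only [normSeventh, dougallSeventhValue, wpSeventh, Finset.sum_range_succ,
      Finset.sum_range_zero, Nat.cast_zero, Nat.cast_one, Nat.cast_ofNat]
    norm_num only
    simp only [gammaSeventh_neg_6, gammaSeventh_neg_2, gammaSeventh_neg_1, gammaSeventh_7, gammaSeventh_8, gammaSeventh_9, gammaSeventh_10, gammaSeventh_11, gammaSeventh_12, gammaSeventh_13, gammaSeventh_14, gammaSeventh_16, gammaSeventh_18]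
    field_simp
    ring

lemma dougallSeventh_neg13_neg9_neg3_neg5 : DougallSeventh (-13) (-9) (-3) (-5) := by
  have h : DougallSeventh 8 4 (-9) (-5) := .of_range (by decide) (by decide) (by decide) (by decide)
    (by decide) (by decide) (by decide) (by decide)
  replace h : DougallSeventh 8 (-3) (-9) (-5) := h.of_add_right (by decide) (by decide) (by decide)
  replace h : DougallSeventh 1 (-3) (-9) (-5) := h.of_add_left (by decide) (by decide) (by decide)
  replace h : DougallSeventh (-6) (-3) (-9) (-5) := h.of_add_left (by decide) (by decide) (by decide)
  replace h : DougallSeventh (-13) (-3) (-9) (-5) := h.of_add_left (by decide) (by decide) (by decide)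
  exact h.swap

lemma dougallSeventh_neg6_neg2_neg3_neg5 : DougallSeventh (-6) (-2) (-3) (-5) := by
  have h : DougallSeventh 8 5 (-3) (-5) := .of_range (by decide) (by decide) (by decide) (by decide)
    (by decide) (by decide) (by decide) (by decide)
  replace h : DougallSeventh 8 (-2) (-3) (-5) := h.of_add_right (by decide) (by decide) (by decide)
  replace h : DougallSeventh 1 (-2) (-3) (-5) := h.of_add_left (by decide) (by decide) (by decide)
  replace h : DougallSeventh (-6) (-2) (-3) (-5) := h.of_add_left (by decide) (by decide) (by decide)
  exact h

lemma kHasValue_four_two_five : KHasValue (1 / 7) 0 (4 / 7) (2 / 7) (5 / 7)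
    (-(33 * (11 - 294 * L3)) / (101 - 2744 * L3)) := by
  -- Here `e + c - d = 1`, so three terms are missing, and two after raising `d`.
  have h0 := kernelIntegral_eq_of_dougall (a := 1) (c := 4) (d := 2) (e := 5) (by decide)
    (by decide) (by decide) 3 rfl rfl rfl (by decide) dougallSeventh_neg13_neg9_neg3_neg5
  have h1 := kernelIntegral_eq_of_dougall (a := 1) (c := 4) (d := 9) (e := 5) (by decide)
    (by decide) (by decide) 2 rfl rfl rfl (by decide) dougallSeventh_neg6_neg2_neg3_neg5
  have g1 : gammaSeventh 1 ≠ 0 := gammaSeventh_ne_zero (by decide)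
  have g2 : gammaSeventh 2 ≠ 0 := gammaSeventh_ne_zero (by decide)
  have g3 : gammaSeventh 3 ≠ 0 := gammaSeventh_ne_zero (by decide)
  have g4 : gammaSeventh 4 ≠ 0 := gammaSeventh_ne_zero (by decide)
  have g5 : gammaSeventh 5 ≠ 0 := gammaSeventh_ne_zero (by decide)
  have g6 : gammaSeventh 6 ≠ 0 := gammaSeventh_ne_zero (by decide)
  have key := kHasValue_of_mul_eq (a := 1) (c := 4) (d := 2) (e := 5) (by decide) (by decide)
    (u := -(33 * (11 - 294 * L3))) (v := 101 - 2744 * L3) (fun hu hv => by linarith) ?_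
  · simpa using key
  · rw [show (2 : ℤ) + 7 = 9 from rfl, h0, h1, L3_eq]
    simp only [normSeventh, dougallSeventhValue, wpSeventh, Finset.sum_range_succ,
      Finset.sum_range_zero, Nat.cast_zero, Nat.cast_one, Nat.cast_ofNat]
    norm_num only
    simp only [gammaSeventh_neg_13, gammaSeventh_neg_9, gammaSeventh_neg_6, gammaSeventh_neg_5, gammaSeventh_neg_3, gammaSeventh_neg_2, gammaSeventh_neg_1, gammaSeventh_7, gammaSeventh_8, gammaSeventh_9, gammaSeventh_10, gammaSeventh_11, gammaSeventh_13, gammaSeventh_14, gammaSeventh_16, gammaSeventh_17, gammaSeventh_18, gammaSeventh_21]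
    field_simp
    ring

theorem mainTheorem5 :
    KHasValue (1 / 7) 0 (2 / 7) (3 / 7) (4 / 7)
      (-(189 * (8 - 5 * K5) / (832 - 525 * K5))) ∧
    KHasValue (1 / 7) 0 (2 / 7) (5 / 7) (3 / 7)
      (-(3 * (5 - 16 * L1) / (23 - 70 * L1))) ∧
    KHasValue (1 / 7) 0 (3 / 7) (4 / 7) (5 / 7)
      (-(21 * (25 - 27 * L2) / (425 - 462 * L2))) ∧
    KHasValue (1 / 7) 0 (4 / 7) (2 / 7) (5 / 7)
      (-(33 * (11 - 294 * L3) / (101 - 2744 * L3))) := by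
  simp only [← neg_div]
  exact ⟨kHasValue_two_three_four, kHasValue_two_five_three, kHasValue_three_four_five, kHasValue_four_two_five⟩
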